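/- Let $I_\mu$ and $K_\mu$ denote the modified Bessel functions of the first and second kind of real order $\mu$: for $x>0$, $I_\mu(x)=\sum_{k\ge0}\frac{(x/2)^{2k+\mu}}{k!\,\Gamma(k+\mu+1)}$ and $K_\mu(x)=\int_0^\infty e^{-x\cosh t}\cosh(\mu t)\,dt$. Let $\nu>-\tfrac12$. For every $\beta<1$ and $x\ge0$ the integrals $\int_x^\infty e^{\beta t}t^{\nu+1}K_\nu(t)\,dt$ and $\int_x^\infty e^{\beta t}t^{\nu}K_\nu(t)\,dt$ converge absolutely, and the following inequalities hold for all $x\ge0$, with the sole exception stated in (i). At $x=0$ each left-hand side is understood as its limit as $x\downarrow0$, which exists and is finite. (i) Let $\beta\le0$. Then $$\frac{e^{-\beta x}I_\nu(x)}{x^\nu}\int_x^\infty e^{\beta t}t^{\nu+1}K_\nu(t)\,dt<1,\qquad \frac{e^{-\beta x}I_{\nu+1}(x)}{x^\nu}\int_x^\infty e^{\beta t}t^{\nu+1}K_\nu(t)\,dt<\frac12,$$ except that in the first inequality there is equality when $x=0$ and $\beta=0$. (ii) Let $\beta\le0$. Then $$\frac{e^{-\beta x}I_\nu(x)}{x^{\nu-1}}\int_x^\infty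 e^{\beta t}t^{\nu}K_\nu(t)\,dt<1,\qquad \frac{e^{-\beta x}I_{\nu+1}(x)}{x^{\nu-1}}\int_x^\infty e^{\beta t}t^{\nu}K_\nu(t)\,dt<\frac12.$$ (iii) Let $0<\beta<1$. Then $$\frac{e^{-\beta x}I_\nu(x)}{x^\nu}\int_x^\infty e^{\beta t}t^{\nu+1}K_\nu(t)\,dt<1+\frac{2\sqrt\pi\,\beta\,\Gamma(\nu+\frac32)}{(1-\beta^2)^{\nu+\frac32}\Gamma(\nu+1)},$$ $$\frac{e^{-\beta x}I_{\nu+1}(x)}{x^\nu}\int_x^\infty e^{\beta t}t^{\nu+1}K_\nu(t)\,dt<\frac12+\frac{\sqrt\pi\,\beta\,\Gamma(\nu+\frac32)}{(1-\beta^2)^{\nu+\frac32}\Gamma(\nu+1)}.$$ (iv) Let $0<\beta<1$. Then $$\frac{e^{-\beta x}I_\nu(x)}{x^{\nu-1}}\int_x^\infty e^{\beta t}t^{\nu}K_\nu(t)\,dt<N_{\nu,\beta},\qquad \frac{e^{-\beta x}I_{\nu+1}(x)}{x^{\nu-1}}\int_x^\infty e^{\beta t}t^{\nu}K_\nu(t)\,dt<N_{\nu,\beta},$$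 where $N_{\nu,\beta}=\frac{1}{2(1-\beta)}$ if $\nu\le\tfrac12$ and $N_{\nu,\beta}=\frac{\sqrt\pi\,\Gamma(\nu+\frac12)}{(1-\beta^2)^{\nu+\frac12}\Gamma(\nu)}$ if $\nu>\tfrac12$. -/

import Mathlib

open Real Set Filter Topology MeasureTheory

/-- The modified Bessel function of the first kind `I_ν(x)` of real order `ν`, at real `x > 0`,
as its power series. (At the poles of `Γ` the term is `0`, as `1 / Γ = 0` there.) -/
noncomputable def besselI (ν x : ℝ) : ℝ :=
  ∑' k : ℕ, (x / 2) ^ (2 * (k : ℝ) + ν) / ((k.factorial : ℝ) * Real.Gamma ((k : ℝ) + ν + 1))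

/-- The modified Bessel function of the second kind `K_ν(x)` of real order `ν`, at real `x > 0`,
`K_ν(x) = ∫_0^∞ exp(-x cosh t) cosh(ν t) dt`. -/
noncomputable def besselK (ν x : ℝ) : ℝ :=
  ∫ t in Ioi (0 : ℝ), Real.exp (-(x * Real.cosh t)) * Real.cosh (ν * t)

/-- The series that defines `besselI` converges at every `x > 0`, for every real order. -/
theorem summable_besselI (ν : ℝ) {x : ℝ} (hx : 0 < x) :
    Summable fun k : ℕ => (x / 2) ^ (2 * (k : ℝ) + ν) /
      ((k.factorial : ℝ) * Real.Gamma ((k : ℝ) + ν + 1)) := by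
  have hpos : ∀ᶠ k : ℕ in atTop, 0 < (k : ℝ) + ν + 1 := by
    filter_upwards [(tendsto_natCast_atTop_atTop (R := ℝ)).eventually_gt_atTop (-ν - 1)] with k hk
    linarith
  have hx2 : 0 < x / 2 := by positivity
  refine summable_of_ratio_test_tendsto_lt_one (l := 0) one_pos ?_ ?_
  · filter_upwards [hpos] with k hk
    have := Real.Gamma_pos_of_pos hk
    positivity
  · have hlim : Tendsto (fun k : ℕ => (x / 2) ^ 2 * ((((k : ℝ) + 1)⁻¹) * ((k : ℝ) + ν + 1)⁻¹))
        atTop (𝓝 0) := by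
      have h1 : Tendsto (fun k : ℕ => ((k : ℝ) + 1)⁻¹) atTop (𝓝 0) :=
        tendsto_inv_atTop_zero.comp
          (tendsto_atTop_add_const_right _ _ tendsto_natCast_atTop_atTop)
      have h2 : Tendsto (fun k : ℕ => ((k : ℝ) + ν + 1)⁻¹) atTop (𝓝 0) := by
        refine tendsto_inv_atTop_zero.comp ?_
        exact tendsto_atTop_add_const_right _ _
          (tendsto_atTop_add_const_right _ _ tendsto_natCast_atTop_atTop)
      simpa using (h1.mul h2).const_mul ((x / 2) ^ 2)
    refine hlim.congr' ?_
    filter_upwards [hpos] with k hk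
    have hG := Real.Gamma_pos_of_pos hk
    have e1 : ((k + 1 : ℕ) : ℝ) + ν + 1 = ((k : ℝ) + ν + 1) + 1 := by push_cast; ring
    have e2 : (2 * ((k + 1 : ℕ) : ℝ) + ν) = (2 * (k : ℝ) + ν) + (2 : ℕ) := by push_cast; ring
    have hk1 : 0 < ((k + 1 : ℕ) : ℝ) + ν + 1 := by rw [e1]; linarith
    have hG1 := Real.Gamma_pos_of_pos hk1
    have hp := Real.rpow_pos_of_pos hx2 (2 * (k : ℝ) + ν)
    have hp1 := Real.rpow_pos_of_pos hx2 (2 * ((k + 1 : ℕ) : ℝ) + ν)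
    rw [Real.norm_of_nonneg (by positivity), Real.norm_of_nonneg (by positivity), e1,
      Real.Gamma_add_one hk.ne', e2, Real.rpow_add_natCast hx2.ne', Nat.factorial_succ]
    push_cast
    field_simp

/-- The integral that defines `besselK` converges at every `x > 0`, for every real order. -/
theorem integrableOn_besselK (ν : ℝ) {x : ℝ} (hx : 0 < x) :
    IntegrableOn (fun t : ℝ => Real.exp (-(x * Real.cosh t)) * Real.cosh (ν * t)) (Ioi 0) := by
  have hg : Integrable fun t : ℝ =>
      Real.exp (ν ^ 2 / x) * Real.exp (-(x / 4) * t ^ 2) :=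
    (integrable_exp_neg_mul_sq (by positivity : 0 < x / 4)).const_mul _
  refine (hg.mono' (by fun_prop) (ae_of_all _ fun t => ?_)).integrableOn
  have hc : 1 + t ^ 2 / 2 ≤ Real.cosh t := by
    have h0 := Real.cosh_sq' (t / 2)
    have h1 : Real.cosh t = 2 * Real.sinh (t / 2) ^ 2 + 1 := by
      have := Real.cosh_two_mul (t / 2)
      rw [mul_div_cancel₀ t (two_ne_zero)] at this
      rw [this, h0]; ring
    have h2 : (t / 2) ^ 2 ≤ Real.sinh (t / 2) ^ 2 := by
      rw [sq_le_sq, Real.abs_sinh]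
      exact Real.self_le_sinh_iff.2 (abs_nonneg _)
    rw [h1]; linarith
  have hcosh : Real.cosh (ν * t) ≤ Real.exp |ν * t| := by
    rw [← Real.cosh_abs, Real.cosh_eq]
    have : Real.exp (-|ν * t|) ≤ Real.exp |ν * t| :=
      Real.exp_le_exp.2 (by linarith [abs_nonneg (ν * t)])
    linarith
  rw [Real.norm_of_nonneg (by positivity)]
  calc Real.exp (-(x * Real.cosh t)) * Real.cosh (ν * t)
      ≤ Real.exp (-(x * Real.cosh t)) * Real.exp |ν * t| := by gcongr
    _ = Real.exp (-(x * Real.cosh t) + |ν * t|) := (Real.exp_add _ _).symm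
    _ ≤ Real.exp (ν ^ 2 / x + -(x / 4) * t ^ 2) := by
        refine Real.exp_le_exp.2 ?_
        have h3 : x * (1 + t ^ 2 / 2) ≤ x * Real.cosh t := by gcongr
        have h4 : |ν * t| ≤ ν ^ 2 / x + x / 4 * t ^ 2 := by
          have h5 : ν ^ 2 / x + x / 4 * t ^ 2 - |ν * t| = (|ν| - x / 2 * |t|) ^ 2 / x := by
            rw [abs_mul, ← sq_abs ν, ← sq_abs t]; field_simp; ring
          have : 0 ≤ (|ν| - x / 2 * |t|) ^ 2 / x := by positivity
          linarith
        nlinarith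
    _ = _ := Real.exp_add _ _

/-- `x ↦ e^{-βx} I_μ(x) x^{-a} ∫_x^∞ e^{βt} t^{a+1} K_ν(t) dt` for `x > 0`.
Here `μ` is the order of `I`; `a = ν` gives the weight `t^{ν+1}` and the factor `x^{-ν}`,
and `a = ν - 1` gives the weight `t^ν` and the factor `x^{1-ν}`. -/
noncomputable def besselTail (μ ν a β x : ℝ) : ℝ :=
  Real.exp (-β * x) * besselI μ x / x ^ a *
    ∫ t in Ioi x, Real.exp (β * t) * t ^ (a + 1) * besselK ν t

/-- `F(x) < C` for all `x ≥ 0`, where `F` is given by a formula for `x > 0` and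
`F(0)` is its limit as `x ↓ 0` (whose existence is part of the claim). -/
def LtOnNonneg (F : ℝ → ℝ) (C : ℝ) : Prop :=
  (∀ x : ℝ, 0 < x → F x < C) ∧ ∃ L : ℝ, Tendsto F (𝓝[>] 0) (𝓝 L) ∧ L < C

/-- The constant `N_{ν,β}`. -/
noncomputable def boundN (ν β : ℝ) : ℝ :=
  if ν ≤ 1 / 2 then 1 / (2 * (1 - β))
  else √π * Real.Gamma (ν + 1 / 2) / ((1 - β ^ 2) ^ (ν + 1 / 2) * Real.Gamma ν)

/-! Write a tail integral as $e^{\beta x}x^{a+1}T$; the quotient to be bounded is then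
$x\,I_\mu(x)\,T$ (`besselTail_eq`). It therefore suffices to bound $T$ by Bessel functions of $K$
type and to bound products $x I K$.

The products come from the Wronskian $x(I_\nu K_{\nu+1}+I_{\nu+1}K_\nu)=1$, which gives $xI_\nu
K_{\nu+1}<1$. Together with the monotonicity of $I_{\nu+1}/I_\nu$ and $K_\nu/K_{\nu+1}$ (Turán-type
inequalities) it also gives $xI_{\nu+1}K_{\nu+1}<\frac12$.

For the weight $t^{\nu+1}$, the identity $(t^{\nu+1}K_{\nu+1})'=-t^{\nu+1}K_\nu$ and integration by
parts give a boundary term with $T=K_{\nu+1}$, plus $\beta\int_x^\infty e^{\beta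
t}t^{\nu+1}K_{\nu+1}$. If $\beta\le0$ the extra term is nonpositive and is dropped, which proves
(i). Since $x\,t^\nu\le t^{\nu+1}$ on the tail, (ii) follows. If $\beta>0$ the extra integral is
controlled by submultiplicativity: $\kappa(t)=t^mK_m(t)$ satisfies
$\kappa(x+s)\kappa(0^+)\le\kappa(x)\kappa(s)$, so the tail at $x$ is at most its boundary value
times the integral over $(0,\infty)$. A Gaussian representation of $\kappa$ bounds the latter by an
explicit two-sided Laplace transform. This gives (iii), and (iv) for $\nu>\frac12$ by lowering the
order by one.

For $\nu\le\frac12$ in (iv), the target is, by the Wronskian, $2(1-\beta)\int_x^\infty e^{\beta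
t}t^\nu K_\nu\,dt<e^{\beta x}x^\nu(K_{\nu+1}+(I_{\nu+1}/I_\nu)K_\nu)$. Here $I_{\nu+1}/I_\nu$ is at
least its value $L(x)=\coth x-1/x$ at $\nu=\frac12$. With $L$ in its place the inequality follows by
differentiation from a rational lower bound on $K_{\nu+1}/K_\nu$ and an elementary inequality for
$\coth$.

At $x=0$, the limit is $0$ in all cases except $I_\nu$ with weight $t^{\nu+1}$, where the boundary
term contributes exactly $1$. -/

/-! ### Signs from a derivative and a boundary limit. -/

theorem tendsto_rpow_nhdsGT_zero {p : ℝ} (hp : 0 < p) :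
    Tendsto (fun x : ℝ => x ^ p) (𝓝[>] 0) (𝓝 0) := by
  have h := (Real.continuousAt_rpow_const 0 p (Or.inr hp.le)).tendsto
  rw [Real.zero_rpow hp.ne'] at h
  exact h.mono_left nhdsWithin_le_nhds

theorem tendsto_id_nhdsGT_zero : Tendsto (fun x : ℝ => x) (𝓝[>] 0) (𝓝 0) :=
  tendsto_id.mono_left nhdsWithin_le_nhds

theorem nonneg_of_deriv_nonneg_of_tendsto_zero {f f' : ℝ → ℝ}
    (hf : ∀ x, 0 < x → HasDerivAt f (f' x) x) (hf' : ∀ x, 0 < x → 0 ≤ f' x)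
    (h0 : Tendsto f (𝓝[>] 0) (𝓝 0)) {x : ℝ} (hx : 0 < x) : 0 ≤ f x := by
  have hmono : MonotoneOn f (Ioi 0) := by
    refine monotoneOn_of_deriv_nonneg (convex_Ioi 0)
      (fun y hy => (hf y hy).continuousAt.continuousWithinAt) ?_ ?_ <;> rw [interior_Ioi]
    · exact fun y hy => (hf y hy).differentiableAt.differentiableWithinAt
    · intro y hy
      rw [(hf y hy).deriv]
      exact hf' y hy
  refine le_of_tendsto h0 ?_
  filter_upwards [Ioo_mem_nhdsGT hx] with y hy
  exact hmono hy.1 hx hy.2.le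

theorem pos_of_deriv_pos_of_tendsto_zero {f f' : ℝ → ℝ}
    (hf : ∀ x, 0 < x → HasDerivAt f (f' x) x) (hf' : ∀ x, 0 < x → 0 < f' x)
    (h0 : Tendsto f (𝓝[>] 0) (𝓝 0)) {x : ℝ} (hx : 0 < x) : 0 < f x := by
  have hmono : StrictMonoOn f (Ioi 0) := by
    refine strictMonoOn_of_deriv_pos (convex_Ioi 0)
      (fun y hy => (hf y hy).continuousAt.continuousWithinAt) ?_
    rw [interior_Ioi]
    intro y hy
    rw [(hf y hy).deriv]
    exact hf' y hy
  exact (nonneg_of_deriv_nonneg_of_tendsto_zero hf (fun y hy => (hf' y hy).le) h0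
    (half_pos hx)).trans_lt (hmono (half_pos hx) hx (half_lt_self hx))

theorem nonneg_of_deriv_nonpos_of_tendsto_atTop {f f' : ℝ → ℝ}
    (hf : ∀ x, 0 < x → HasDerivAt f (f' x) x) (hf' : ∀ x, 0 < x → f' x ≤ 0)
    (h0 : Tendsto f atTop (𝓝 0)) {x : ℝ} (hx : 0 < x) : 0 ≤ f x := by
  have hanti : AntitoneOn f (Ioi 0) := by
    refine antitoneOn_of_deriv_nonpos (convex_Ioi 0)
      (fun y hy => (hf y hy).continuousAt.continuousWithinAt) ?_ ?_ <;> rw [interior_Ioi]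
    · exact fun y hy => (hf y hy).differentiableAt.differentiableWithinAt
    · intro y hy
      rw [(hf y hy).deriv]
      exact hf' y hy
  refine le_of_tendsto h0 ?_
  filter_upwards [eventually_ge_atTop x] with y hy
  exact hanti hx (hx.trans_le hy) hy

/-! ### The functions $I_\mu$: power series, derivatives, ratio. -/

/-- The entire function `∑ z^k / (k! Γ(k+μ+1))`, so that
`I_μ(x) = (x/2)^μ besselSeries μ (x²/4)`. -/
noncomputable def besselSeries (μ z : ℝ) : ℝ :=
  ∑' k : ℕ, z ^ k / ((k.factorial : ℝ) * Real.Gamma ((k : ℝ) + μ + 1))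

theorem besselI_term_eq (μ : ℝ) {x : ℝ} (hx : 0 < x) (k : ℕ) :
    (x / 2) ^ (2 * (k : ℝ) + μ) / ((k.factorial : ℝ) * Real.Gamma ((k : ℝ) + μ + 1)) =
      (x / 2) ^ μ * ((x ^ 2 / 4) ^ k / ((k.factorial : ℝ) * Real.Gamma ((k : ℝ) + μ + 1))) := by
  have h2 : (2 : ℝ) * (k : ℝ) = ((2 * k : ℕ) : ℝ) := by push_cast; ring
  rw [Real.rpow_add (by positivity), h2, Real.rpow_natCast, pow_mul,
    show (x / 2) ^ 2 = x ^ 2 / 4 by ring]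
  ring

theorem besselI_eq (μ : ℝ) {x : ℝ} (hx : 0 < x) :
    besselI μ x = (x / 2) ^ μ * besselSeries μ (x ^ 2 / 4) := by
  simp only [besselI, besselSeries, besselI_term_eq μ hx, tsum_mul_left]

theorem summable_besselSeries (μ z : ℝ) :
    Summable fun k : ℕ => z ^ k / ((k.factorial : ℝ) * Real.Gamma ((k : ℝ) + μ + 1)) := by
  -- The added $1$ keeps $x$ positive even at $z=0$, so the known convergence of the series of
  -- $I_\mu(x)$ dominates.
  set x : ℝ := 2 * √(|z| + 1) with hxdef
  have hz : 0 < |z| + 1 := by positivity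
  have hx : 0 < x := by positivity
  have hx2 : x ^ 2 / 4 = |z| + 1 := by
    rw [hxdef, mul_pow, Real.sq_sqrt hz.le]; ring
  have h := summable_besselI μ hx
  simp only [besselI_term_eq μ hx, hx2] at h
  have h' := ((summable_mul_left_iff (Real.rpow_pos_of_pos (half_pos hx) μ).ne').1 h).norm
  refine Summable.of_norm_bounded h' fun k => ?_
  rw [norm_div, norm_div, norm_pow, norm_pow]
  gcongr
  rw [Real.norm_eq_abs, Real.norm_of_nonneg hz.le]
  linarith

theorem besselSeries_pos {μ z : ℝ} (hμ : -1 < μ) (hz : 0 ≤ z) : 0 < besselSeries μ z := by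
  have hG : ∀ k : ℕ, 0 < Real.Gamma ((k : ℝ) + μ + 1) := fun k =>
    Real.Gamma_pos_of_pos (by have : (0 : ℝ) ≤ k := k.cast_nonneg; linarith)
  refine (summable_besselSeries μ z).tsum_pos (fun k => ?_) 0 ?_
  · have := hG k
    positivity
  · have := hG 0
    simp only [pow_zero]
    positivity

theorem hasDerivAt_besselSeries (μ z : ℝ) :
    HasDerivAt (besselSeries μ) (besselSeries (μ + 1) z) z := by
  set R : ℝ := |z| + 1
  have hterm : ∀ (w : ℝ) (k : ℕ), ((k + 1 : ℕ) : ℝ) * w ^ k /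
      (((k + 1).factorial : ℝ) * Real.Gamma (((k + 1 : ℕ) : ℝ) + μ + 1)) =
      w ^ k / ((k.factorial : ℝ) * Real.Gamma ((k : ℝ) + (μ + 1) + 1)) := by
    intro w k
    rw [show ((k + 1 : ℕ) : ℝ) + μ + 1 = (k : ℝ) + (μ + 1) + 1 by push_cast; ring,
      Nat.factorial_succ]
    have : ((k + 1 : ℕ) : ℝ) ≠ 0 := by positivity
    rw [Nat.cast_mul, mul_assoc, mul_div_mul_left _ _ this]
  have hsum : ∀ w : ℝ, Summable fun k : ℕ => (k : ℝ) * w ^ (k - 1) /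
      ((k.factorial : ℝ) * Real.Gamma ((k : ℝ) + μ + 1)) := by
    intro w
    rw [← summable_nat_add_iff 1]
    simpa only [Nat.add_sub_cancel, hterm] using summable_besselSeries (μ + 1) w
  have key := hasDerivAt_tsum_of_isPreconnected (𝕜 := ℝ) (F := ℝ)
    (g := fun (k : ℕ) (w : ℝ) => w ^ k / ((k.factorial : ℝ) * Real.Gamma ((k : ℝ) + μ + 1)))
    (g' := fun (k : ℕ) (w : ℝ) => (k : ℝ) * w ^ (k - 1) /
      ((k.factorial : ℝ) * Real.Gamma ((k : ℝ) + μ + 1)))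
    (t := Metric.ball 0 R) (y₀ := 0) (y := z) (hsum R).norm Metric.isOpen_ball
    (convex_ball 0 R).isPreconnected ?_ ?_ ?_ (summable_besselSeries μ 0) ?_
  · refine key.congr_deriv ?_
    rw [(hsum z).tsum_eq_zero_add]
    simp only [Nat.add_sub_cancel, hterm]
    simp [besselSeries]
  · intro k w _
    exact (hasDerivAt_pow k w).div_const _
  · intro k w hw
    rw [mem_ball_zero_iff] at hw
    have hR : |R| = R := abs_of_pos (by positivity)
    simp only [norm_div, norm_mul, norm_pow, Real.norm_eq_abs R, hR]
    gcongr
  · exact Metric.mem_ball_self (by positivity)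
  · rw [mem_ball_zero_iff, Real.norm_eq_abs]
    exact lt_add_one _

theorem besselSeries_zero (μ : ℝ) : besselSeries μ 0 = (Real.Gamma (μ + 1))⁻¹ := by
  rw [besselSeries, tsum_eq_single 0]
  · simp
  · intro k hk
    simp [hk]

/-- Termwise, $1/\Gamma(k+\mu+1)=((\mu+1)+k)/\Gamma(k+\mu+2)$; the part with factor $k$ is shifted
by one index. -/
theorem besselSeries_recurrence {μ : ℝ} (hμ : -1 < μ) (z : ℝ) :
    besselSeries μ z = (μ + 1) * besselSeries (μ + 1) z + z * besselSeries (μ + 2) z := by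
  have hterm : ∀ k : ℕ, z * (z ^ k / ((k.factorial : ℝ) * Real.Gamma ((k : ℝ) + (μ + 2) + 1))) =
      ((k + 1 : ℕ) : ℝ) * z ^ (k + 1) /
        (((k + 1).factorial : ℝ) * Real.Gamma (((k + 1 : ℕ) : ℝ) + μ + 2)) := by
    intro k
    rw [show ((k + 1 : ℕ) : ℝ) + μ + 2 = (k : ℝ) + (μ + 2) + 1 by push_cast; ring,
      Nat.factorial_succ]
    have : ((k + 1 : ℕ) : ℝ) ≠ 0 := by positivity
    rw [Nat.cast_mul, mul_assoc, mul_div_mul_left _ _ this]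
    ring
  have hs : Summable fun k : ℕ => (k : ℝ) * z ^ k /
      ((k.factorial : ℝ) * Real.Gamma ((k : ℝ) + μ + 2)) := by
    rw [← summable_nat_add_iff 1]
    simpa only [hterm] using (summable_besselSeries (μ + 2) z).mul_left z
  have h2 : z * besselSeries (μ + 2) z = ∑' k : ℕ, (k : ℝ) * z ^ k /
      ((k.factorial : ℝ) * Real.Gamma ((k : ℝ) + μ + 2)) := by
    rw [hs.tsum_eq_zero_add, besselSeries, ← tsum_mul_left]
    simp only [hterm]
    simp
  rw [h2, besselSeries, besselSeries, ← tsum_mul_left,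
    ← ((summable_besselSeries (μ + 1) z).mul_left (μ + 1)).tsum_add hs]
  refine tsum_congr fun k => ?_
  have hk : 0 < (k : ℝ) + μ + 1 := by have : (0 : ℝ) ≤ k := k.cast_nonneg; linarith
  have hG := Real.Gamma_pos_of_pos hk
  rw [show (k : ℝ) + (μ + 1) + 1 = (k : ℝ) + μ + 1 + 1 by ring,
    show (k : ℝ) + μ + 2 = (k : ℝ) + μ + 1 + 1 by ring, Real.Gamma_add_one hk.ne']
  have : (k.factorial : ℝ) ≠ 0 := by positivity
  field_simp
  ring

theorem besselI_pos {μ x : ℝ} (hμ : -1 < μ) (hx : 0 < x) : 0 < besselI μ x := by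
  rw [besselI_eq μ hx]
  have := besselSeries_pos hμ (by positivity : 0 ≤ x ^ 2 / 4)
  positivity

theorem hasDerivAt_besselI (μ : ℝ) {x : ℝ} (hx : 0 < x) :
    HasDerivAt (besselI μ) (besselI (μ + 1) x + μ / x * besselI μ x) x := by
  have h1 : HasDerivAt (fun x : ℝ => x / 2) (1 / 2) x := (hasDerivAt_id x).div_const 2
  have h2 : HasDerivAt (fun x : ℝ => x ^ 2 / 4) (x / 2) x :=
    ((hasDerivAt_pow 2 x).div_const 4).congr_deriv (by norm_num; ring)
  have h3 := (h1.rpow_const (p := μ) (Or.inl (half_pos hx).ne')).mul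
    ((hasDerivAt_besselSeries μ (x ^ 2 / 4)).comp x h2)
  refine (h3.congr_of_eventuallyEq ?_).congr_deriv ?_
  · filter_upwards [lt_mem_nhds hx] with t ht
    exact besselI_eq μ ht
  · rw [besselI_eq μ hx, besselI_eq (μ + 1) hx, Real.rpow_add_one (half_pos hx).ne',
      Real.rpow_sub_one (half_pos hx).ne']
    simp only [Function.comp]
    field_simp
    ring

theorem hasDerivAt_besselI_succ {μ x : ℝ} (hμ : -1 < μ) (hx : 0 < x) :
    HasDerivAt (besselI (μ + 1)) (besselI μ x - (μ + 1) / x * besselI (μ + 1) x) x := by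
  refine (hasDerivAt_besselI (μ + 1) hx).congr_deriv ?_
  have h := besselSeries_recurrence hμ (x ^ 2 / 4)
  rw [show μ + 1 + 1 = μ + 2 by ring, besselI_eq μ hx, besselI_eq (μ + 1) hx,
    besselI_eq (μ + 2) hx, h, Real.rpow_add_one (half_pos hx).ne',
    show μ + 2 = μ + (2 : ℕ) by push_cast; ring, Real.rpow_add_natCast (half_pos hx).ne']
  field_simp
  ring

theorem tendsto_besselI_div_rpow (μ : ℝ) :
    Tendsto (fun x => besselI μ x / x ^ μ) (𝓝[>] 0) (𝓝 (2 ^ μ * Real.Gamma (μ + 1))⁻¹) := by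
  have hc : Tendsto (fun x : ℝ => ((2 : ℝ) ^ μ)⁻¹ * besselSeries μ (x ^ 2 / 4)) (𝓝[>] 0)
      (𝓝 (((2 : ℝ) ^ μ)⁻¹ * besselSeries μ (0 ^ 2 / 4))) := by
    refine Tendsto.mono_left ?_ nhdsWithin_le_nhds
    have h1 : ContinuousAt (fun x : ℝ => x ^ 2 / 4) 0 := by fun_prop
    exact ((hasDerivAt_besselSeries μ _).continuousAt.comp
      (f := fun x : ℝ => x ^ 2 / 4) (x := 0) h1).tendsto.const_mul _
  rw [mul_inv, ← besselSeries_zero]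
  refine (by simpa using hc : Tendsto _ _ _).congr' ?_
  filter_upwards [self_mem_nhdsWithin] with x hx
  have hx : 0 < x := hx
  rw [besselI_eq μ hx, Real.div_rpow hx.le zero_le_two]
  have := (Real.rpow_pos_of_pos hx μ).ne'
  field_simp

theorem tendsto_besselI_div_rpow_zero {μ a : ℝ} (h : a < μ) :
    Tendsto (fun x => besselI μ x / x ^ a) (𝓝[>] 0) (𝓝 0) := by
  have h1 := (tendsto_rpow_nhdsGT_zero (sub_pos.2 h)).mul (tendsto_besselI_div_rpow μ)
  rw [zero_mul] at h1
  refine h1.congr' ?_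
  filter_upwards [self_mem_nhdsWithin] with x hx
  have hx : 0 < x := hx
  have h1 := (Real.rpow_pos_of_pos hx μ).ne'
  have h2 := (Real.rpow_pos_of_pos hx a).ne'
  rw [Real.rpow_sub hx]
  field_simp

/-- The two derivative formulas give $(x(I_\mu^2-I_{\mu+1}^2))'=(2\mu+1)(I_\mu^2+I_{\mu+1}^2)>0$,
and the function vanishes at $0$. -/
theorem besselI_succ_lt {μ x : ℝ} (hμ : -1 / 2 < μ) (hx : 0 < x) :
    besselI (μ + 1) x < besselI μ x := by
  have hμ1 : -1 < μ := by linarith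
  have key : 0 < x * (besselI μ x ^ 2 - besselI (μ + 1) x ^ 2) := by
    refine pos_of_deriv_pos_of_tendsto_zero
      (f := fun x => x * (besselI μ x ^ 2 - besselI (μ + 1) x ^ 2))
      (f' := fun x => (2 * μ + 1) * (besselI μ x ^ 2 + besselI (μ + 1) x ^ 2)) ?_ ?_ ?_ hx
    · intro y hy
      refine ((hasDerivAt_id y).mul (((hasDerivAt_besselI μ hy).pow 2).sub
        ((hasDerivAt_besselI_succ hμ1 hy).pow 2))).congr_deriv ?_
      simp only [id, Pi.pow_apply, Pi.sub_apply]
      field_simp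
      push_cast
      ring
    · intro y hy
      have := besselI_pos hμ1 hy
      have : 0 < 2 * μ + 1 := by linarith
      positivity
    -- The exponent $-\frac12$ absorbs the factor: $xI^2=(I/x^{-1/2})^2$. This is where
    -- $\mu>-\frac12$ gives the limit $0$.
    · have h1 := tendsto_besselI_div_rpow_zero (μ := μ) (a := -1 / 2) hμ
      have h2 := tendsto_besselI_div_rpow_zero (μ := μ + 1) (a := -1 / 2) (by linarith)
      have h3 := (h1.pow 2).sub (h2.pow 2)
      norm_num at h3
      refine h3.congr' ?_
      filter_upwards [self_mem_nhdsWithin] with y hy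
      have hy : 0 < y := hy
      have : (y ^ (-(1 / 2) : ℝ)) ^ 2 = y⁻¹ := by
        rw [← Real.rpow_natCast, ← Real.rpow_mul hy.le]
        norm_num [Real.rpow_neg_one]
      rw [div_pow, div_pow, this]
      field_simp
  have h1 : 0 < besselI μ x ^ 2 - besselI (μ + 1) x ^ 2 := pos_of_mul_pos_right key hx.le
  exact lt_of_pow_lt_pow_left₀ 2 (besselI_pos hμ1 hx).le (by linarith)

/-- The ratio `I_{μ+1} / I_μ` is increasing. -/
theorem besselI_turan {μ x : ℝ} (hμ : -1 / 2 < μ) (hx : 0 < x) :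
    0 ≤ x * (besselI μ x ^ 2 - besselI (μ + 1) x ^ 2) -
      (2 * μ + 1) * (besselI μ x * besselI (μ + 1) x) := by
  have hμ1 : -1 < μ := by linarith
  -- With one more factor $x$ the derivative collapses to $x(I_\mu^2-I_{\mu+1}^2)$, whose sign is
  -- known.
  have key : 0 ≤ x ^ 2 * (besselI μ x ^ 2 - besselI (μ + 1) x ^ 2) -
      (2 * μ + 1) * (x * (besselI μ x * besselI (μ + 1) x)) := by
    refine nonneg_of_deriv_nonneg_of_tendsto_zero
      (f := fun x => x ^ 2 * (besselI μ x ^ 2 - besselI (μ + 1) x ^ 2) -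
        (2 * μ + 1) * (x * (besselI μ x * besselI (μ + 1) x)))
      (f' := fun x => x * (besselI μ x ^ 2 - besselI (μ + 1) x ^ 2)) ?_ ?_ ?_ hx
    · intro y hy
      refine (((hasDerivAt_pow 2 y).mul (((hasDerivAt_besselI μ hy).pow 2).sub
        ((hasDerivAt_besselI_succ hμ1 hy).pow 2))).sub (((hasDerivAt_id y).mul
        ((hasDerivAt_besselI μ hy).mul (hasDerivAt_besselI_succ hμ1 hy))).const_mul
          (2 * μ + 1))).congr_deriv ?_
      simp only [id, Pi.pow_apply, Pi.sub_apply, Pi.mul_apply]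
      field_simp
      push_cast
      ring
    · intro y hy
      have h1 := besselI_succ_lt hμ hy
      have h2 := besselI_pos (μ := μ + 1) (by linarith) hy
      have : besselI (μ + 1) y ^ 2 ≤ besselI μ y ^ 2 := by gcongr
      have : 0 ≤ besselI μ y ^ 2 - besselI (μ + 1) y ^ 2 := by linarith
      positivity
    · have h1 := tendsto_besselI_div_rpow_zero (μ := μ) (a := -1 / 2) hμ
      have h2 := tendsto_besselI_div_rpow_zero (μ := μ + 1) (a := -1 / 2) (by linarith)
      have h3 := (tendsto_id_nhdsGT_zero.mul ((h1.pow 2).sub (h2.pow 2))).sub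
        ((h1.mul h2).const_mul (2 * μ + 1))
      norm_num at h3
      refine h3.congr' ?_
      filter_upwards [self_mem_nhdsWithin] with y hy
      have hy : 0 < y := hy
      have : (y ^ (-(1 / 2) : ℝ)) * (y ^ (-(1 / 2) : ℝ)) = y⁻¹ := by
        rw [← Real.rpow_add hy]
        norm_num [Real.rpow_neg_one]
      rw [div_pow, div_pow, div_mul_div_comm, sq (y ^ (-(1 / 2) : ℝ)), this]
      field_simp
  have h2 : x ^ 2 * (besselI μ x ^ 2 - besselI (μ + 1) x ^ 2) -
      (2 * μ + 1) * (x * (besselI μ x * besselI (μ + 1) x)) =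
      x * (x * (besselI μ x ^ 2 - besselI (μ + 1) x ^ 2) -
      (2 * μ + 1) * (besselI μ x * besselI (μ + 1) x)) := by ring
  rw [h2] at key
  exact nonneg_of_mul_nonneg_right key hx

/-! ### The functions $K_\nu$: order comparison, derivatives, ratio. -/

theorem setIntegral_pos_of_pos {f : ℝ → ℝ} {s : Set ℝ} (hs : MeasurableSet s)
    (hs0 : 0 < volume s) (hf : IntegrableOn f s) (hpos : ∀ t ∈ s, 0 < f t) :
    0 < ∫ t in s, f t := by
  rw [setIntegral_pos_iff_support_of_nonneg_ae
    ((ae_restrict_mem hs).mono fun t ht => (hpos t ht).le) hf]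
  have : Function.support f ∩ s = s :=
    inter_eq_right.2 fun t ht => (hpos t ht).ne'
  rwa [this]

theorem setIntegral_Ioi_pos {f : ℝ → ℝ} {a : ℝ} (hf : IntegrableOn f (Ioi a))
    (hpos : ∀ t, a < t → 0 < f t) : 0 < ∫ t in Ioi a, f t :=
  setIntegral_pos_of_pos measurableSet_Ioi (by simp) hf hpos

theorem besselK_pos (ν : ℝ) {x : ℝ} (hx : 0 < x) : 0 < besselK ν x :=
  setIntegral_Ioi_pos (integrableOn_besselK ν hx) fun t _ => by positivity

theorem besselK_le_of_abs_le {ν μ x : ℝ} (h : |ν| ≤ |μ|) (hx : 0 < x) :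
    besselK ν x ≤ besselK μ x := by
  refine setIntegral_mono_on (integrableOn_besselK ν hx) (integrableOn_besselK μ hx)
    measurableSet_Ioi fun t _ => ?_
  gcongr ?_ * ?_
  rw [Real.cosh_le_cosh, abs_mul, abs_mul]
  gcongr

theorem besselK_le_exp_mul (ν : ℝ) {x : ℝ} (hx : 1 ≤ x) :
    besselK ν x ≤ Real.exp 1 * besselK ν 1 * Real.exp (-x) := by
  have h : besselK ν x ≤ ∫ t in Ioi (0 : ℝ), Real.exp (1 - x) *
      (Real.exp (-(1 * Real.cosh t)) * Real.cosh (ν * t)) := by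
    refine setIntegral_mono_on (integrableOn_besselK ν (by linarith))
      ((integrableOn_besselK ν one_pos).const_mul _) measurableSet_Ioi fun t _ => ?_
    rw [← mul_assoc, ← Real.exp_add]
    gcongr
    nlinarith [Real.one_le_cosh t]
  rw [integral_const_mul, Real.exp_sub] at h
  refine h.trans_eq ?_
  rw [Real.exp_neg, besselK]
  ring

theorem cosh_mul_cosh (a b : ℝ) :
    Real.cosh a * Real.cosh b = (Real.cosh (a + b) + Real.cosh (a - b)) / 2 := by
  rw [Real.cosh_add, Real.cosh_sub]; ring

theorem sinh_mul_sinh (a b : ℝ) :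
    Real.sinh a * Real.sinh b = (Real.cosh (a + b) - Real.cosh (a - b)) / 2 := by
  rw [Real.cosh_add, Real.cosh_sub]; ring

/-- Differentiation under the integral sign brings down $-\cosh t$, and the product formula for
$\cosh t\cosh\nu t$ splits it into neighbouring orders. The integrand at $x/2$ dominates near $x$.
-/
theorem hasDerivAt_besselK_half (ν : ℝ) {x : ℝ} (hx : 0 < x) :
    HasDerivAt (besselK ν) (-(besselK (ν + 1) x + besselK (ν - 1) x) / 2) x := by
  have hterm : ∀ y t : ℝ, Real.exp (-(y * Real.cosh t)) * -Real.cosh t * Real.cosh (ν * t) =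
      -1 / 2 * (Real.exp (-(y * Real.cosh t)) * Real.cosh ((ν + 1) * t) +
        Real.exp (-(y * Real.cosh t)) * Real.cosh ((ν - 1) * t)) := by
    intro y t
    have := cosh_mul_cosh (ν * t) t
    rw [show (ν + 1) * t = ν * t + t by ring, show (ν - 1) * t = ν * t - t by ring]
    linear_combination (-Real.exp (-(y * Real.cosh t))) * this
  have hint : ∀ y : ℝ, 0 < y → IntegrableOn (fun t : ℝ =>
      Real.exp (-(y * Real.cosh t)) * -Real.cosh t * Real.cosh (ν * t)) (Ioi 0) := by
    intro y hy
    simp only [hterm]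
    exact ((integrableOn_besselK (ν + 1) hy).add (integrableOn_besselK (ν - 1) hy)).const_mul _
  have key := hasDerivAt_integral_of_dominated_loc_of_deriv_le
    (μ := volume.restrict (Ioi (0 : ℝ))) (s := Ioi (x / 2)) (x₀ := x)
    (F := fun y t => Real.exp (-(y * Real.cosh t)) * Real.cosh (ν * t))
    (F' := fun y t => Real.exp (-(y * Real.cosh t)) * -Real.cosh t * Real.cosh (ν * t))
    (bound := fun t => ‖Real.exp (-(x / 2 * Real.cosh t)) * -Real.cosh t * Real.cosh (ν * t)‖)
    (Ioi_mem_nhds (half_lt_self hx)) (Eventually.of_forall fun y => by fun_prop)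
    (integrableOn_besselK ν hx) (by fun_prop) (ae_of_all _ fun t y hy => ?_)
    (hint _ (half_pos hx)).norm (ae_of_all _ fun t y hy => ?_)
  · refine key.2.congr_deriv ?_
    simp only [hterm, integral_const_mul]
    rw [integral_add (integrableOn_besselK (ν + 1) hx) (integrableOn_besselK (ν - 1) hx)]
    simp only [besselK]
    ring
  · have hy : x / 2 < y := hy
    have hc := (Real.cosh_pos t).le
    rw [norm_mul, norm_mul, norm_mul, norm_mul, Real.norm_of_nonneg (Real.exp_pos _).le,
      Real.norm_of_nonneg (Real.exp_pos _).le]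
    gcongr
  · have h1 : HasDerivAt (fun y : ℝ => -(y * Real.cosh t)) (-Real.cosh t) y :=
      ((hasDerivAt_id y).mul_const (Real.cosh t)).neg.congr_deriv (by rw [one_mul])
    exact h1.exp.mul_const _

theorem tendsto_exp_neg_mul_cosh_mul_sinh (ν : ℝ) {x : ℝ} (hx : 0 < x) :
    Tendsto (fun t : ℝ => Real.exp (-(x * Real.cosh t)) * Real.sinh (ν * t)) atTop (𝓝 0) := by
  have hlim : Tendsto (fun t : ℝ => x / 4 * t ^ 2 - |ν| * t) atTop atTop := by
    have h1 : Tendsto (fun t : ℝ => x / 4 * t + -|ν|) atTop atTop :=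
      tendsto_atTop_add_const_right _ _ (tendsto_id.const_mul_atTop (by positivity))
    refine (tendsto_id.atTop_mul_atTop₀ h1).congr fun t => ?_
    simp only [id]; ring
  refine squeeze_zero_norm' ?_ (Real.tendsto_exp_neg_atTop_nhds_zero.comp hlim)
  filter_upwards [eventually_ge_atTop 0] with t ht
  have h1 : |Real.sinh (ν * t)| ≤ Real.exp (|ν| * t) := by
    rw [Real.abs_sinh, abs_mul, abs_of_nonneg ht, Real.sinh_eq]
    have := Real.exp_pos (|ν| * t)
    have := Real.exp_pos (-(|ν| * t))
    linarith
  have h2 : t ^ 2 / 4 ≤ Real.cosh t := by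
    have h3 := Real.quadratic_le_exp_of_nonneg ht
    have := Real.exp_pos (-t)
    rw [Real.cosh_eq]
    nlinarith
  rw [norm_mul, Real.norm_of_nonneg (Real.exp_pos _).le, Real.norm_eq_abs]
  calc Real.exp (-(x * Real.cosh t)) * |Real.sinh (ν * t)|
      ≤ Real.exp (-(x * (t ^ 2 / 4))) * Real.exp (|ν| * t) := by gcongr
    _ = _ := by
      rw [← Real.exp_add]
      simp only [Function.comp]
      congr 1
      ring

/-- The derivative of $e^{-x\cosh t}\sinh\nu t$ has integral $0$ over $(0,\infty)$; expand $\sinh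
t\sinh\nu t$. -/
theorem besselK_recurrence (ν : ℝ) {x : ℝ} (hx : 0 < x) :
    x * (besselK (ν + 1) x - besselK (ν - 1) x) = 2 * ν * besselK ν x := by
  have hterm : ∀ t : ℝ, Real.exp (-(x * Real.cosh t)) * -(x * Real.sinh t) * Real.sinh (ν * t) +
      Real.exp (-(x * Real.cosh t)) * (Real.cosh (ν * t) * ν) =
      (-x / 2 * (Real.exp (-(x * Real.cosh t)) * Real.cosh ((ν + 1) * t) -
        Real.exp (-(x * Real.cosh t)) * Real.cosh ((ν - 1) * t))) +
        ν * (Real.exp (-(x * Real.cosh t)) * Real.cosh (ν * t)) := by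
    intro t
    have := sinh_mul_sinh (ν * t) t
    rw [show (ν + 1) * t = ν * t + t by ring, show (ν - 1) * t = ν * t - t by ring]
    linear_combination (-x * Real.exp (-(x * Real.cosh t))) * this
  have hi : IntegrableOn (fun t : ℝ => -x / 2 * (Real.exp (-(x * Real.cosh t)) *
      Real.cosh ((ν + 1) * t) - Real.exp (-(x * Real.cosh t)) * Real.cosh ((ν - 1) * t)))
      (Ioi 0) :=
    ((integrableOn_besselK (ν + 1) hx).sub (integrableOn_besselK (ν - 1) hx)).const_mul _
  have hi2 := (integrableOn_besselK ν hx).const_mul ν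
  have key := integral_Ioi_of_hasDerivAt_of_tendsto' (a := 0) (m := 0)
    (f := fun t : ℝ => Real.exp (-(x * Real.cosh t)) * Real.sinh (ν * t))
    (f' := fun t : ℝ => Real.exp (-(x * Real.cosh t)) * -(x * Real.sinh t) * Real.sinh (ν * t) +
      Real.exp (-(x * Real.cosh t)) * (Real.cosh (ν * t) * ν)) (fun t _ => ?_) ?_
    (tendsto_exp_neg_mul_cosh_mul_sinh ν hx)
  · simp only [hterm] at key
    rw [integral_add hi hi2] at key
    simp only [integral_const_mul] at key
    rw [integral_sub (integrableOn_besselK (ν + 1) hx) (integrableOn_besselK (ν - 1) hx)] at key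
    simp only [mul_zero, Real.sinh_zero, sub_zero] at key
    simp only [besselK]
    linarith
  · have h1 : HasDerivAt (fun y : ℝ => -(x * Real.cosh y)) (-(x * Real.sinh t)) t :=
      ((Real.hasDerivAt_cosh t).const_mul x).neg
    have h2 : HasDerivAt (fun y : ℝ => Real.sinh (ν * y)) (Real.cosh (ν * t) * ν) t := by
      simpa using ((hasDerivAt_id t).const_mul ν).sinh
    exact h1.exp.mul h2
  · simp only [hterm]
    exact hi.add hi2

theorem hasDerivAt_besselK (ν : ℝ) {x : ℝ} (hx : 0 < x) :
    HasDerivAt (besselK ν) (-besselK (ν + 1) x + ν / x * besselK ν x) x := by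
  refine (hasDerivAt_besselK_half ν hx).congr_deriv ?_
  have := besselK_recurrence ν hx
  field_simp
  linear_combination this

theorem hasDerivAt_besselK_succ (ν : ℝ) {x : ℝ} (hx : 0 < x) :
    HasDerivAt (besselK (ν + 1)) (-besselK ν x - (ν + 1) / x * besselK (ν + 1) x) x := by
  refine (hasDerivAt_besselK_half (ν + 1) hx).congr_deriv ?_
  have := besselK_recurrence (ν + 1) hx
  rw [add_sub_cancel_right] at this ⊢
  field_simp
  linear_combination -this

theorem continuousOn_besselK (ν : ℝ) : ContinuousOn (besselK ν) (Ioi 0) :=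
  fun _ hx => (hasDerivAt_besselK ν hx).continuousAt.continuousWithinAt

theorem besselK_le_succ {μ x : ℝ} (hμ : -1 / 2 < μ) (hx : 0 < x) :
    besselK μ x ≤ besselK (μ + 1) x := by
  refine besselK_le_of_abs_le ?_ hx
  rw [abs_of_pos (by linarith : 0 < μ + 1), abs_le]
  constructor <;> linarith

theorem tendsto_exp_mul_rpow_mul_besselK (ν p : ℝ) {β : ℝ} (hβ : β < 1) :
    Tendsto (fun x => Real.exp (β * x) * x ^ p * besselK ν x) atTop (𝓝 0) := by
  have h := (tendsto_rpow_mul_exp_neg_mul_atTop_nhds_zero p (1 - β) (by linarith)).const_mul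
    (Real.exp 1 * besselK ν 1)
  rw [mul_zero] at h
  refine squeeze_zero_norm' ?_ h
  filter_upwards [eventually_ge_atTop 1] with x hx
  have hx0 : 0 < x := by linarith
  have hK := besselK_pos ν hx0
  have hp := Real.rpow_pos_of_pos hx0 p
  rw [Real.norm_of_nonneg (by positivity)]
  calc Real.exp (β * x) * x ^ p * besselK ν x
      ≤ Real.exp (β * x) * x ^ p * (Real.exp 1 * besselK ν 1 * Real.exp (-x)) := by
        gcongr; exact besselK_le_exp_mul ν hx
    _ = Real.exp 1 * besselK ν 1 * (x ^ p * Real.exp (-(1 - β) * x)) := by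
        rw [show -(1 - β) * x = β * x + -x by ring, Real.exp_add]; ring

theorem tendsto_rpow_mul_besselK (ν p : ℝ) :
    Tendsto (fun x => x ^ p * besselK ν x) atTop (𝓝 0) := by
  simpa using tendsto_exp_mul_rpow_mul_besselK ν p zero_lt_one

/-- The ratio `K_μ / K_{μ+1}` is increasing. -/
theorem besselK_turan {μ x : ℝ} (hμ : -1 / 2 < μ) (hx : 0 < x) :
    0 ≤ x * (besselK μ x ^ 2 - besselK (μ + 1) x ^ 2) +
      (2 * μ + 1) * (besselK μ x * besselK (μ + 1) x) := by
  -- The counterpart of the argument for $I$, run from infinity: the derivative is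
  -- $x(K_\mu^2-K_{\mu+1}^2)\le0$ and the limit at infinity is $0$.
  have key : 0 ≤ x ^ 2 * (besselK μ x ^ 2 - besselK (μ + 1) x ^ 2) +
      (2 * μ + 1) * (x * (besselK μ x * besselK (μ + 1) x)) := by
    refine nonneg_of_deriv_nonpos_of_tendsto_atTop
      (f := fun x => x ^ 2 * (besselK μ x ^ 2 - besselK (μ + 1) x ^ 2) +
        (2 * μ + 1) * (x * (besselK μ x * besselK (μ + 1) x)))
      (f' := fun x => x * (besselK μ x ^ 2 - besselK (μ + 1) x ^ 2)) ?_ ?_ ?_ hx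
    · intro y hy
      refine (((hasDerivAt_pow 2 y).mul (((hasDerivAt_besselK μ hy).pow 2).sub
        ((hasDerivAt_besselK_succ μ hy).pow 2))).add (((hasDerivAt_id y).mul
        ((hasDerivAt_besselK μ hy).mul (hasDerivAt_besselK_succ μ hy))).const_mul
          (2 * μ + 1))).congr_deriv ?_
      simp only [id, Pi.pow_apply, Pi.sub_apply, Pi.mul_apply]
      field_simp
      push_cast
      ring
    · intro y hy
      have h1 := besselK_le_succ hμ hy
      have h2 := besselK_pos μ hy
      have : besselK μ y ^ 2 ≤ besselK (μ + 1) y ^ 2 := by gcongr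
      exact mul_nonpos_of_nonneg_of_nonpos hy.le (by linarith)
    · have h0 := tendsto_rpow_mul_besselK μ 1
      have h1 := tendsto_rpow_mul_besselK (μ + 1) 1
      have h2 := tendsto_rpow_mul_besselK (μ + 1) 0
      have h3 := ((h0.pow 2).sub (h1.pow 2)).add ((h0.mul h2).const_mul (2 * μ + 1))
      norm_num at h3
      refine h3.congr fun y => ?_
      ring
  have h2 : x ^ 2 * (besselK μ x ^ 2 - besselK (μ + 1) x ^ 2) +
      (2 * μ + 1) * (x * (besselK μ x * besselK (μ + 1) x)) =
      x * (x * (besselK μ x ^ 2 - besselK (μ + 1) x ^ 2) +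
      (2 * μ + 1) * (besselK μ x * besselK (μ + 1) x)) := by ring
  rw [h2] at key
  exact nonneg_of_mul_nonneg_right key hx

/-! ### Gaussian representation of $x^mK_m(x)$, behaviour at $0$, integrability. -/

theorem integrableOn_rpow_mul_exp_neg {m : ℝ} (hm : 0 < m) :
    IntegrableOn (fun u : ℝ => u ^ (m - 1) * Real.exp (-u)) (Ioi 0) := by
  refine (Real.GammaIntegral_convergent hm).congr_fun (fun u _ => mul_comm _ _) measurableSet_Ioi

theorem integral_rpow_mul_exp_neg {m : ℝ} (hm : 0 < m) :
    ∫ u in Ioi (0 : ℝ), u ^ (m - 1) * Real.exp (-u) = Real.Gamma m := by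
  simpa using Real.integral_rpow_mul_exp_neg_mul_Ioi hm one_pos

theorem norm_gaussian_kernel_le (m t : ℝ) {u : ℝ} (hu : 0 < u) :
    ‖u ^ (m - 1) * Real.exp (-u - t ^ 2 / (4 * u))‖ ≤ u ^ (m - 1) * Real.exp (-u) := by
  have := Real.rpow_pos_of_pos hu (m - 1)
  rw [Real.norm_of_nonneg (by positivity)]
  gcongr
  have : 0 ≤ t ^ 2 / (4 * u) := by positivity
  linarith

theorem integrableOn_gaussian_kernel {m : ℝ} (hm : 0 < m) (t : ℝ) :
    IntegrableOn (fun u : ℝ => u ^ (m - 1) * Real.exp (-u - t ^ 2 / (4 * u))) (Ioi 0) :=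
  (integrableOn_rpow_mul_exp_neg hm).mono' (by fun_prop)
    ((ae_restrict_mem measurableSet_Ioi).mono fun _ hu => norm_gaussian_kernel_le m t hu)

theorem image_mul_exp {c : ℝ} (hc : 0 < c) : (fun t : ℝ => c * Real.exp t) '' univ = Ioi 0 := by
  ext u
  simp only [image_univ, mem_range, mem_Ioi]
  constructor
  · rintro ⟨t, rfl⟩
    positivity
  · intro hu
    refine ⟨Real.log (u / c), ?_⟩
    rw [Real.exp_log (by positivity)]
    field_simp

/-- `x^m K_m(x) = 2^{m-1} ∫_0^∞ u^{m-1} e^{-u-x²/(4u)} du`. -/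
theorem rpow_mul_besselK_eq {m x : ℝ} (hm : 0 < m) (hx : 0 < x) :
    x ^ m * besselK m x =
      2 ^ (m - 1) * ∫ u in Ioi (0 : ℝ), u ^ (m - 1) * Real.exp (-u - x ^ 2 / (4 * u)) := by
  have hc : 0 < x / 2 := half_pos hx
  -- The substitution $u=\frac x2e^t$ turns $-u-x^2/(4u)$ into $-x\cosh t$; symmetrising in $t$ then
  -- turns $e^{mt}$ into $\cosh mt$ on the half-line.
  have hderiv : ∀ t ∈ (univ : Set ℝ), HasDerivWithinAt (fun t : ℝ => x / 2 * Real.exp t)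
      (x / 2 * Real.exp t) univ t :=
    fun t _ => ((Real.hasDerivAt_exp t).const_mul _).hasDerivWithinAt
  have hinj : InjOn (fun t : ℝ => x / 2 * Real.exp t) univ := fun a _ b _ hab =>
    Real.exp_injective (mul_left_cancel₀ hc.ne' hab)
  have hsub : ∀ t : ℝ, |x / 2 * Real.exp t| • ((x / 2 * Real.exp t) ^ (m - 1) *
      Real.exp (-(x / 2 * Real.exp t) - x ^ 2 / (4 * (x / 2 * Real.exp t)))) =
      (x / 2) ^ m * (Real.exp (-(x * Real.cosh t)) * Real.exp (m * t)) := by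
    intro t
    have hu : 0 < x / 2 * Real.exp t := by positivity
    rw [abs_of_pos hu, smul_eq_mul, Real.rpow_sub_one hu.ne', Real.mul_rpow hc.le
      (Real.exp_pos t).le, ← Real.exp_mul, mul_comm t m]
    have : -(x / 2 * Real.exp t) - x ^ 2 / (4 * (x / 2 * Real.exp t)) = -(x * Real.cosh t) := by
      rw [Real.cosh_eq, Real.exp_neg]
      field_simp
      ring
    rw [this]
    field_simp
  have hint : Integrable fun t : ℝ => Real.exp (-(x * Real.cosh t)) * Real.exp (m * t) := by
    have h := (integrableOn_image_iff_integrableOn_abs_deriv_smul MeasurableSet.univ hderiv hinj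
      (fun u => u ^ (m - 1) * Real.exp (-u - x ^ 2 / (4 * u)))).1
      (by rw [image_mul_exp hc]; exact integrableOn_gaussian_kernel hm x)
    simp only [hsub] at h
    rw [integrableOn_univ] at h
    exact (integrable_const_mul_iff (isUnit_iff_ne_zero.2 (Real.rpow_pos_of_pos hc m).ne') _).1 h
  have hcv := integral_image_eq_integral_abs_deriv_smul MeasurableSet.univ hderiv hinj
    (fun u => u ^ (m - 1) * Real.exp (-u - x ^ 2 / (4 * u)))
  rw [image_mul_exp hc] at hcv
  simp only [hsub, setIntegral_univ, integral_const_mul] at hcv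
  have hneg : ∫ t : ℝ, Real.exp (-(x * Real.cosh t)) * Real.exp (-(m * t)) =
      ∫ t : ℝ, Real.exp (-(x * Real.cosh t)) * Real.exp (m * t) := by
    rw [← integral_neg_eq_self]
    simp
  have hint' : Integrable fun t : ℝ => Real.exp (-(x * Real.cosh t)) * Real.exp (-(m * t)) := by
    simpa using hint.comp_neg
  have heven : ∫ t : ℝ, Real.exp (-(x * Real.cosh t)) * Real.cosh (m * t) = 2 * besselK m x := by
    rw [besselK, ← integral_comp_abs
      (f := fun t => Real.exp (-(x * Real.cosh t)) * Real.cosh (m * t))]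
    congr 1 with t
    rw [Real.cosh_abs, ← Real.cosh_abs (m * t), ← Real.cosh_abs (m * |t|)]
    simp [abs_mul]
  have hsum : ∫ t : ℝ, Real.exp (-(x * Real.cosh t)) * Real.cosh (m * t) =
      ∫ t : ℝ, Real.exp (-(x * Real.cosh t)) * Real.exp (m * t) := by
    calc _ = ∫ t : ℝ, (Real.exp (-(x * Real.cosh t)) * Real.exp (m * t) +
          Real.exp (-(x * Real.cosh t)) * Real.exp (-(m * t))) / 2 := by
          congr 1 with t
          rw [Real.cosh_eq (m * t)]
          ring
      _ = _ := by
          rw [integral_div, integral_add hint hint', hneg]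
          ring
  rw [hcv, ← hsum, heven, Real.div_rpow hx.le zero_le_two, Real.rpow_sub_one two_ne_zero]
  have := Real.rpow_pos_of_pos zero_lt_two m
  field_simp

theorem rpow_mul_besselK_le {m x : ℝ} (hm : 0 < m) (hx : 0 < x) :
    x ^ m * besselK m x ≤ 2 ^ (m - 1) * Real.Gamma m := by
  rw [rpow_mul_besselK_eq hm hx, ← integral_rpow_mul_exp_neg hm]
  gcongr ?_ * ?_
  exact setIntegral_mono_on (integrableOn_gaussian_kernel hm x) (integrableOn_rpow_mul_exp_neg hm)
    measurableSet_Ioi fun u hu => (le_abs_self _).trans (norm_gaussian_kernel_le m x hu)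

theorem tendsto_rpow_mul_besselK_nhdsGT_zero {m : ℝ} (hm : 0 < m) :
    Tendsto (fun x => x ^ m * besselK m x) (𝓝[>] 0) (𝓝 (2 ^ (m - 1) * Real.Gamma m)) := by
  have h : Tendsto (fun x : ℝ => ∫ u in Ioi (0 : ℝ), u ^ (m - 1) *
      Real.exp (-u - x ^ 2 / (4 * u))) (𝓝[>] 0)
      (𝓝 (∫ u in Ioi (0 : ℝ), u ^ (m - 1) * Real.exp (-u))) := by
    refine tendsto_integral_filter_of_dominated_convergence
      (fun u => u ^ (m - 1) * Real.exp (-u)) (Eventually.of_forall fun x => by fun_prop)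
      (Eventually.of_forall fun x => ?_) (integrableOn_rpow_mul_exp_neg hm)
      (ae_of_all _ fun u => ?_)
    · exact (ae_restrict_mem measurableSet_Ioi).mono fun u hu => norm_gaussian_kernel_le m x hu
    · have hc : Continuous fun x : ℝ => u ^ (m - 1) * Real.exp (-u - x ^ 2 / (4 * u)) := by
        fun_prop
      simpa using (hc.tendsto 0).mono_left nhdsWithin_le_nhds
  rw [integral_rpow_mul_exp_neg hm] at h
  refine (h.const_mul _).congr' ?_
  filter_upwards [self_mem_nhdsWithin] with x hx
  exact (rpow_mul_besselK_eq hm hx).symm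

theorem integrableOn_exp_mul_rpow_mul_besselK {ν p β : ℝ} (hν : -1 / 2 < ν) (hp : ν ≤ p)
    (hβ : β < 1) :
    IntegrableOn (fun t : ℝ => Real.exp (β * t) * t ^ p * besselK ν t) (Ioi 0) := by
  -- Near $0$, $K_\nu\le K_\sigma=O(t^{-\sigma})$ needs a positive order with $|\nu|\le\sigma$ and
  -- $p-\sigma>-1$. The value $\frac12$ meets both when $-\frac12<\nu\le\frac12$.
  set σ : ℝ := max ν (1 / 2) with hσ
  have hσ1 : 1 / 2 ≤ σ := le_max_right _ _
  have hσ0 : 0 < σ := by linarith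
  have hνσ : |ν| ≤ |σ| := by
    rw [abs_of_pos hσ0, abs_le]
    exact ⟨by linarith, le_max_left _ _⟩
  have hpσ : -1 < p - σ := by
    have : σ < p + 1 := max_lt (by linarith) (by linarith)
    linarith
  have hmeas : ∀ s : Set ℝ, MeasurableSet s → s ⊆ Ioi 0 → AEStronglyMeasurable
      (fun t : ℝ => Real.exp (β * t) * t ^ p * besselK ν t) (volume.restrict s) := by
    intro s hs hs0
    refine ContinuousOn.aestronglyMeasurable ?_ hs
    refine ContinuousOn.mul (ContinuousOn.mul (by fun_prop) ?_) ((continuousOn_besselK ν).mono hs0)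
    exact fun t ht => (Real.continuousAt_rpow_const t p (Or.inl (hs0 ht).ne')).continuousWithinAt
  rw [← Ioc_union_Ioi_eq_Ioi zero_le_one]
  refine IntegrableOn.union ?_ ?_
  · have hi : IntegrableOn (fun t : ℝ => Real.exp |β| * (2 ^ (σ - 1) * Real.Gamma σ) * t ^ (p - σ))
        (Ioc 0 1) := by
      refine Integrable.const_mul ?_ _
      have := intervalIntegral.intervalIntegrable_rpow' (a := 0) (b := 1) hpσ
      rwa [intervalIntegrable_iff_integrableOn_Ioc_of_le zero_le_one] at this
    refine hi.mono' (hmeas _ measurableSet_Ioc Ioc_subset_Ioi_self)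
      ((ae_restrict_mem measurableSet_Ioc).mono fun t ht => ?_)
    have ht0 : 0 < t := ht.1
    have h1 := rpow_mul_besselK_le hσ0 ht0
    have h2 := besselK_le_of_abs_le hνσ ht0
    have h3 := besselK_pos ν ht0
    have hp0 := Real.rpow_pos_of_pos ht0 p
    have hp1 := Real.rpow_pos_of_pos ht0 (p - σ)
    have hp2 := Real.rpow_pos_of_pos ht0 σ
    have hβt : β * t ≤ |β| := by
      calc β * t ≤ |β| * t := by gcongr; exact le_abs_self β
        _ ≤ |β| * 1 := by gcongr; exact ht.2
        _ = |β| := mul_one _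
    rw [Real.norm_of_nonneg (by positivity)]
    calc Real.exp (β * t) * t ^ p * besselK ν t
        ≤ Real.exp |β| * t ^ p * besselK σ t := by gcongr
      _ = Real.exp |β| * (t ^ σ * besselK σ t) * t ^ (p - σ) := by
          rw [Real.rpow_sub ht0]; field_simp
      _ ≤ _ := by gcongr
  · have hi : IntegrableOn (fun t : ℝ => Real.exp 1 * besselK ν 1 *
        (t ^ p * Real.exp (-(1 - β) * t ^ (1 : ℝ)))) (Ioi 1) :=
      ((integrableOn_rpow_mul_exp_neg_mul_rpow (by linarith) one_pos (by linarith)).mono_set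
        (Ioi_subset_Ioi zero_le_one)).const_mul _
    refine hi.mono' (hmeas _ measurableSet_Ioi (Ioi_subset_Ioi zero_le_one))
      ((ae_restrict_mem measurableSet_Ioi).mono fun t ht => ?_)
    have ht : 1 < t := ht
    have ht0 : 0 < t := by linarith
    have h3 := besselK_pos ν ht0
    have hp0 := Real.rpow_pos_of_pos ht0 p
    rw [Real.norm_of_nonneg (by positivity), Real.rpow_one]
    calc Real.exp (β * t) * t ^ p * besselK ν t
        ≤ Real.exp (β * t) * t ^ p * (Real.exp 1 * besselK ν 1 * Real.exp (-t)) := by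
          gcongr; exact besselK_le_exp_mul ν ht.le
      _ = _ := by
          rw [show -(1 - β) * t = β * t + -t by ring, Real.exp_add]; ring

/-! ### The Laplace transform of $|t|^mK_m(|t|)$. -/

theorem exp_mul_sub_sq_div (β t : ℝ) {u : ℝ} (hu : 0 < u) :
    Real.exp (β * t) * Real.exp (-u - t ^ 2 / (4 * u)) =
      Real.exp (-(1 - β ^ 2) * u) * Real.exp (-(1 / (4 * u)) * (t - 2 * u * β) ^ 2) := by
  rw [← Real.exp_add, ← Real.exp_add]
  congr 1
  field_simp
  ring

/-- The two-sided Laplace transform of `|t|^m K_m(|t|)` in the Gaussian representation. -/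
theorem integral_exp_mul_gaussian_kernel {m β : ℝ} (hm : 0 < m) (hβ : β ^ 2 < 1) :
    Integrable (fun t : ℝ => ∫ u in Ioi (0 : ℝ),
      Real.exp (β * t) * (u ^ (m - 1) * Real.exp (-u - t ^ 2 / (4 * u)))) ∧
    ∫ t : ℝ, ∫ u in Ioi (0 : ℝ),
      Real.exp (β * t) * (u ^ (m - 1) * Real.exp (-u - t ^ 2 / (4 * u))) =
      2 * √π * Real.Gamma (m + 1 / 2) / (1 - β ^ 2) ^ (m + 1 / 2) := by
  have hb : 0 < 1 - β ^ 2 := by linarith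
  set F : ℝ → ℝ → ℝ := fun u t =>
    Real.exp (β * t) * (u ^ (m - 1) * Real.exp (-u - t ^ 2 / (4 * u))) with hF
  have hF_eq : ∀ u : ℝ, 0 < u → F u = fun t => u ^ (m - 1) * Real.exp (-(1 - β ^ 2) * u) *
      Real.exp (-(1 / (4 * u)) * (t - 2 * u * β) ^ 2) := by
    intro u hu
    ext t
    have := exp_mul_sub_sq_div β t hu
    rw [hF]
    linear_combination u ^ (m - 1) * this
  have hint : ∀ u : ℝ, 0 < u → Integrable (F u) := by
    intro u hu
    rw [hF_eq u hu]
    exact ((integrable_exp_neg_mul_sq (by positivity : 0 < 1 / (4 * u))).comp_sub_right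
      (2 * u * β)).const_mul _
  have hval : ∀ u : ℝ, 0 < u → ∫ t, F u t =
      2 * √π * (u ^ ((m + 1 / 2) - 1) * Real.exp (-((1 - β ^ 2) * u))) := by
    intro u hu
    rw [hF_eq u hu, integral_const_mul,
      integral_sub_right_eq_self (fun t => Real.exp (-(1 / (4 * u)) * t ^ 2)) (2 * u * β),
      integral_gaussian, show π / (1 / (4 * u)) = 2 ^ 2 * (π * u) by field_simp; norm_num,
      Real.sqrt_mul (by positivity), Real.sqrt_sq zero_le_two, Real.sqrt_mul Real.pi_pos.le,
      show m + 1 / 2 - 1 = (m - 1) + 1 / 2 by ring, Real.rpow_add hu, ← Real.sqrt_eq_rpow,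
      show -(1 - β ^ 2) * u = -((1 - β ^ 2) * u) by ring]
    ring
  have hval_int : IntegrableOn (fun u : ℝ => 2 * √π * (u ^ ((m + 1 / 2) - 1) *
      Real.exp (-((1 - β ^ 2) * u)))) (Ioi 0) := by
    refine Integrable.const_mul ?_ _
    have := integrableOn_rpow_mul_exp_neg_mul_rpow (p := 1) (s := m + 1 / 2 - 1)
      (by linarith) one_pos hb
    simp only [Real.rpow_one, neg_mul] at this
    exact this
  -- The kernel is nonnegative, so joint integrability reduces to the iterated integral with $t$
  -- inside: a Gaussian in $t$, then a Gamma integral in $u$.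
  have hprod : Integrable (Function.uncurry F) ((volume.restrict (Ioi 0)).prod volume) := by
    have hmeas : Measurable (Function.uncurry F) := by
      simp only [hF, Function.uncurry_def]
      fun_prop
    rw [integrable_prod_iff hmeas.aestronglyMeasurable]
    refine ⟨(ae_restrict_mem measurableSet_Ioi).mono fun u hu => hint u hu, ?_⟩
    refine IntegrableOn.congr_fun hval_int (fun u hu => ?_) measurableSet_Ioi
    have hu : 0 < u := hu
    rw [← hval u hu]
    refine integral_congr_ae (ae_of_all _ fun t => ?_)
    have := Real.rpow_pos_of_pos hu (m - 1)
    exact (Real.norm_of_nonneg (by simp only [hF]; positivity)).symm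
  refine ⟨hprod.integral_prod_right, ?_⟩
  rw [← integral_integral_swap hprod, setIntegral_congr_fun measurableSet_Ioi
    (fun u hu => hval u hu), integral_const_mul,
    Real.integral_rpow_mul_exp_neg_mul_Ioi (by linarith) hb, Real.div_rpow zero_le_one hb.le,
    Real.one_rpow]
  ring

/-- The right side is the integral over the whole line; the negative half-line, with strictly
positive mass, is discarded. -/
theorem integral_exp_mul_rpow_mul_besselK_lt {m β : ℝ} (hm : 0 < m) (hβ : β ^ 2 < 1) :
    ∫ t in Ioi (0 : ℝ), Real.exp (β * t) * t ^ m * besselK m t <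
      2 ^ m * √π * Real.Gamma (m + 1 / 2) / (1 - β ^ 2) ^ (m + 1 / 2) := by
  obtain ⟨hint, hval⟩ := integral_exp_mul_gaussian_kernel hm hβ
  set k : ℝ → ℝ := fun t => ∫ u in Ioi (0 : ℝ),
    Real.exp (β * t) * (u ^ (m - 1) * Real.exp (-u - t ^ 2 / (4 * u))) with hk
  have hkpos : ∀ t, 0 < k t := fun t =>
    setIntegral_Ioi_pos ((integrableOn_gaussian_kernel hm t).const_mul _) fun u hu => by
      have := Real.rpow_pos_of_pos hu (m - 1)
      positivity
  have hsplit := intervalIntegral.integral_Iic_add_Ioi (b := 0) hint.integrableOn hint.integrableOn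
  have hneg : 0 < ∫ t in Iic (0 : ℝ), k t :=
    setIntegral_pos_of_pos measurableSet_Iic (by simp) hint.integrableOn fun t _ => hkpos t
  have hI : ∫ t in Ioi (0 : ℝ), Real.exp (β * t) * t ^ m * besselK m t =
      2 ^ (m - 1) * ∫ t in Ioi (0 : ℝ), k t := by
    rw [← integral_const_mul]
    refine setIntegral_congr_fun measurableSet_Ioi fun t ht => ?_
    simp only [hk]
    rw [mul_assoc, rpow_mul_besselK_eq hm ht, integral_const_mul]
    ring
  have h2 : (2 : ℝ) ^ m = 2 ^ (m - 1) * 2 := by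
    rw [Real.rpow_sub_one two_ne_zero]; ring
  have h3 : 0 < (2 : ℝ) ^ (m - 1) := by positivity
  calc _ < 2 ^ (m - 1) * ∫ t, k t := by
        rw [hI]
        gcongr
        linarith
    _ = _ := by rw [hval, h2]; ring

/-! ### Submultiplicativity of $t^mK_m(t)$. -/

theorem hasDerivAt_rpow_mul_besselK (μ : ℝ) {x : ℝ} (hx : 0 < x) :
    HasDerivAt (fun x => x ^ (μ + 1) * besselK (μ + 1) x) (-(x ^ (μ + 1) * besselK μ x)) x := by
  refine ((Real.hasDerivAt_rpow_const (Or.inl hx.ne')).mul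
    (hasDerivAt_besselK_succ μ hx)).congr_deriv ?_
  rw [add_sub_cancel_right, Real.rpow_add_one hx.ne']
  field_simp
  ring

theorem besselK_ratio_mono {μ x y : ℝ} (hμ : -1 / 2 < μ) (hx : 0 < x) (hxy : x ≤ y) :
    besselK μ x * besselK (μ + 1) y ≤ besselK μ y * besselK (μ + 1) x := by
  have hderiv : ∀ t, 0 < t → HasDerivAt (fun t => besselK μ t / besselK (μ + 1) t)
      ((t * (besselK μ t ^ 2 - besselK (μ + 1) t ^ 2) +
        (2 * μ + 1) * (besselK μ t * besselK (μ + 1) t)) / (t * besselK (μ + 1) t ^ 2)) t := by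
    intro t ht
    have hK := (besselK_pos (μ + 1) ht).ne'
    refine ((hasDerivAt_besselK μ ht).div (hasDerivAt_besselK_succ μ ht) hK).congr_deriv ?_
    field_simp
    ring
  have hmono : MonotoneOn (fun t => besselK μ t / besselK (μ + 1) t) (Ioi 0) := by
    refine monotoneOn_of_deriv_nonneg (convex_Ioi 0)
      (fun y hy => (hderiv y hy).continuousAt.continuousWithinAt) ?_ ?_ <;> rw [interior_Ioi]
    · exact fun y hy => (hderiv y hy).differentiableAt.differentiableWithinAt
    · intro y hy
      rw [(hderiv y hy).deriv]
      have h1 := besselK_turan hμ hy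
      have h2 : 0 < y := hy
      positivity
  have h := hmono hx (hx.trans_le hxy : (0 : ℝ) < y) hxy
  rwa [div_le_div_iff₀ (besselK_pos _ hx) (besselK_pos _ (hx.trans_le hxy))] at h

/-- The function `t^m K_m(t)`, normalised to be `1` at `0`, is submultiplicative for `m ≥ 1/2`. -/
theorem rpow_mul_besselK_add_le {μ x s : ℝ} (hμ : -1 / 2 < μ) (hx : 0 < x) (hs : 0 < s) :
    (x + s) ^ (μ + 1) * besselK (μ + 1) (x + s) * (2 ^ μ * Real.Gamma (μ + 1)) ≤
      x ^ (μ + 1) * besselK (μ + 1) x * (s ^ (μ + 1) * besselK (μ + 1) s) := by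
  set κ : ℝ → ℝ := fun t => t ^ (μ + 1) * besselK (μ + 1) t with hκ
  have hκpos : ∀ t, 0 < t → 0 < κ t := fun t ht =>
    mul_pos (Real.rpow_pos_of_pos ht _) (besselK_pos _ ht)
  have hd : ∀ t, 0 < t → HasDerivAt κ (-(t ^ (μ + 1) * besselK μ t)) t :=
    fun t ht => hasDerivAt_rpow_mul_besselK μ ht
  -- The logarithmic derivative of $\kappa$ is $-K_\mu/K_{\mu+1}$, nonincreasing by
  -- `besselK_ratio_mono`. So $\kappa(x+t)/\kappa(t)$ decreases in $t$ and is at most its limit as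
  -- $t\downarrow0$.
  have hderiv : ∀ t, 0 < t → HasDerivAt (fun t => κ (x + t) / κ t)
      ((-((x + t) ^ (μ + 1) * besselK μ (x + t)) * κ t -
        κ (x + t) * -(t ^ (μ + 1) * besselK μ t)) / κ t ^ 2) t := by
    intro t ht
    exact ((hd (x + t) (by linarith)).comp_const_add x t).div (hd t ht) (hκpos t ht).ne'
  have hanti : AntitoneOn (fun t => κ (x + t) / κ t) (Ioi 0) := by
    refine antitoneOn_of_deriv_nonpos (convex_Ioi 0)
      (fun y hy => (hderiv y hy).continuousAt.continuousWithinAt) ?_ ?_ <;> rw [interior_Ioi]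
    · exact fun y hy => (hderiv y hy).differentiableAt.differentiableWithinAt
    · intro t ht
      rw [(hderiv t ht).deriv]
      have ht : 0 < t := ht
      have h1 := besselK_ratio_mono hμ ht (by linarith : t ≤ x + t)
      refine div_nonpos_of_nonpos_of_nonneg ?_ (sq_nonneg _)
      have h2 : 0 < (x + t) ^ (μ + 1) * t ^ (μ + 1) :=
        mul_pos (Real.rpow_pos_of_pos (by linarith) _) (Real.rpow_pos_of_pos ht _)
      have h3 := mul_le_mul_of_nonneg_left h1 h2.le
      simp only [hκ]
      linarith
  have hc0 : 0 < (2 : ℝ) ^ μ * Real.Gamma (μ + 1) :=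
    mul_pos (Real.rpow_pos_of_pos two_pos _) (Real.Gamma_pos_of_pos (by linarith))
  have hlim : Tendsto (fun t => κ (x + t) / κ t) (𝓝[>] 0)
      (𝓝 (κ x / (2 ^ μ * Real.Gamma (μ + 1)))) := by
    have h1 : Tendsto (fun t => κ (x + t)) (𝓝[>] 0) (𝓝 (κ x)) := by
      have h2 : Tendsto (fun t : ℝ => x + t) (𝓝[>] 0) (𝓝 x) := by
        simpa using tendsto_id_nhdsGT_zero.const_add x
      exact (hd x hx).continuousAt.tendsto.comp h2
    have h3 := tendsto_rpow_mul_besselK_nhdsGT_zero (m := μ + 1) (by linarith)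
    rw [add_sub_cancel_right] at h3
    exact h1.div h3 hc0.ne'
  have h : κ (x + s) / κ s ≤ κ x / (2 ^ μ * Real.Gamma (μ + 1)) := by
    refine ge_of_tendsto hlim ?_
    filter_upwards [Ioo_mem_nhdsGT hs] with t ht
    exact hanti ht.1 hs ht.2.le
  rwa [div_le_div_iff₀ (hκpos s hs) hc0] at h

/-! ### The Wronskian and bounds for products $xIK$. -/

theorem besselI_mul_besselK_wronskian {μ x : ℝ} (hμ : -1 / 2 < μ) (hx : 0 < x) :
    x * (besselI μ x * besselK (μ + 1) x + besselI (μ + 1) x * besselK μ x) = 1 := by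
  have hμ1 : -1 < μ := by linarith
  have hderiv : ∀ t, 0 < t → HasDerivAt
      (fun t => t * (besselI μ t * besselK (μ + 1) t + besselI (μ + 1) t * besselK μ t)) 0 t := by
    intro t ht
    refine ((hasDerivAt_id t).mul (((hasDerivAt_besselI μ ht).mul
      (hasDerivAt_besselK_succ μ ht)).add ((hasDerivAt_besselI_succ hμ1 ht).mul
      (hasDerivAt_besselK μ ht)))).congr_deriv ?_
    simp only [id, Pi.add_apply, Pi.mul_apply]
    field_simp
    ring
  have hG : 0 < (2 : ℝ) ^ μ * Real.Gamma (μ + 1) :=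
    mul_pos (Real.rpow_pos_of_pos two_pos _) (Real.Gamma_pos_of_pos (by linarith))
  have hK := tendsto_rpow_mul_besselK_nhdsGT_zero (m := μ + 1) (by linarith)
  rw [add_sub_cancel_right] at hK
  have h1 := (tendsto_besselI_div_rpow μ).mul hK
  rw [inv_mul_cancel₀ hG.ne'] at h1
  have h2 := (tendsto_besselI_div_rpow_zero (μ := μ + 1) (a := μ) (by linarith)).mul hK
  rw [zero_mul] at h2
  have heq : ∀ ν t : ℝ, 0 < t → besselI ν t / t ^ μ * (t ^ (μ + 1) * besselK (μ + 1) t) =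
      t * (besselI ν t * besselK (μ + 1) t) := by
    intro ν t ht
    have := (Real.rpow_pos_of_pos ht μ).ne'
    rw [Real.rpow_add_one ht.ne']
    field_simp
  have h3 : Tendsto (fun t => t * (besselI (μ + 1) t * besselK μ t)) (𝓝[>] 0) (𝓝 0) := by
    refine squeeze_zero' ?_ ?_ h2 <;> filter_upwards [self_mem_nhdsWithin] with t ht
    · have ht : 0 < t := ht
      have h4 := besselI_pos (μ := μ + 1) (by linarith) ht
      have h5 := besselK_pos μ ht
      positivity
    · have ht : 0 < t := ht
      have h4 := besselI_pos (μ := μ + 1) (by linarith) ht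
      rw [heq _ t ht]
      gcongr
      exact besselK_le_succ hμ ht
  have hlim : Tendsto (fun t => t * (besselI μ t * besselK (μ + 1) t +
      besselI (μ + 1) t * besselK μ t)) (𝓝[>] 0) (𝓝 1) := by
    have h4 := h1.add h3
    rw [add_zero] at h4
    refine h4.congr' ?_
    filter_upwards [self_mem_nhdsWithin] with t ht
    rw [heq _ t ht, mul_add]
  refine le_antisymm ?_ ?_
  · have := nonneg_of_deriv_nonneg_of_tendsto_zero (fun t ht => (hderiv t ht).const_sub 1)
      (fun t _ => by simp) (by simpa using hlim.const_sub 1) hx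
    linarith
  · have := nonneg_of_deriv_nonneg_of_tendsto_zero (fun t ht => (hderiv t ht).sub_const 1)
      (fun t _ => le_rfl) (by simpa using hlim.sub_const 1) hx
    linarith

theorem mul_besselI_mul_besselK_succ_lt_one {μ x : ℝ} (hμ : -1 / 2 < μ) (hx : 0 < x) :
    x * (besselI μ x * besselK (μ + 1) x) < 1 := by
  have h1 := besselI_mul_besselK_wronskian hμ hx
  have h2 := besselI_pos (μ := μ + 1) (by linarith) hx
  have h3 := besselK_pos μ hx
  have : 0 < x * (besselI (μ + 1) x * besselK μ x) := by positivity
  linarith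

/-- With $i,j=I_\mu,I_{\mu+1}$ and $k,l=K_\mu,K_{\mu+1}$, adding $kl$ times the inequality for $I$
to $ij$ times that for $K$ cancels the $2\mu+1$ terms and leaves $x(ik-jl)(il+jk)\ge0$, so $ik\ge
jl$. Then $i(il+jk-2jl)\ge l(i-j)^2>0$, and $x(il+jk)=1$. -/
theorem mul_besselI_mul_besselK_lt_half {μ x : ℝ} (hμ : -1 / 2 < μ) (hx : 0 < x) :
    x * (besselI (μ + 1) x * besselK (μ + 1) x) < 1 / 2 := by
  have hW := besselI_mul_besselK_wronskian hμ hx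
  have hTI := besselI_turan hμ hx
  have hTK := besselK_turan hμ hx
  have hlt := besselI_succ_lt hμ hx
  have hi := besselI_pos (μ := μ) (by linarith) hx
  have hj := besselI_pos (μ := μ + 1) (by linarith) hx
  have hk := besselK_pos μ hx
  have hl := besselK_pos (μ + 1) hx
  generalize besselI μ x = i at *
  generalize besselI (μ + 1) x = j at *
  generalize besselK μ x = k at *
  generalize besselK (μ + 1) x = l at *
  have h1 : 0 ≤ x * ((i * k - j * l) * (i * l + j * k)) := by
    have h2 := mul_nonneg hTI (mul_pos hk hl).le
    have h3 := mul_nonneg hTK (mul_pos hi hj).le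
    linarith
  have h2 : 0 ≤ i * k - j * l :=
    nonneg_of_mul_nonneg_left (nonneg_of_mul_nonneg_right h1 hx) (by positivity)
  have h3 : 0 < i * (i * l + j * k - 2 * (j * l)) := by
    have h4 : 0 < l * (i - j) ^ 2 := mul_pos hl (pow_pos (sub_pos.2 hlt) 2)
    have h5 := mul_nonneg hj.le h2
    nlinarith
  have h4 := mul_pos hx (pos_of_mul_pos_right h3 hi.le)
  linarith

/-! ### Tail integrals: integration by parts and the bound for $\beta>0$. -/

theorem integrableOn_tail {ν p β x : ℝ} (hν : -1 / 2 < ν) (hp : ν ≤ p) (hβ : β < 1)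
    (hx : 0 ≤ x) :
    IntegrableOn (fun t : ℝ => Real.exp (β * t) * t ^ p * besselK ν t) (Ioi x) :=
  (integrableOn_exp_mul_rpow_mul_besselK hν hp hβ).mono_set (Ioi_subset_Ioi hx)

theorem integral_tail_pos {ν p β x : ℝ} (hν : -1 / 2 < ν) (hp : ν ≤ p) (hβ : β < 1)
    (hx : 0 ≤ x) :
    0 < ∫ t in Ioi x, Real.exp (β * t) * t ^ p * besselK ν t := by
  refine setIntegral_Ioi_pos (integrableOn_tail hν hp hβ hx) fun t ht => ?_
  have ht0 : 0 < t := hx.trans_lt ht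
  have h1 := besselK_pos ν ht0
  positivity

theorem tendsto_integral_tail {ν p β : ℝ} (hν : -1 / 2 < ν) (hp : ν ≤ p) (hβ : β < 1) :
    Tendsto (fun x => ∫ t in Ioi x, Real.exp (β * t) * t ^ p * besselK ν t) (𝓝[>] 0)
      (𝓝 (∫ t in Ioi 0, Real.exp (β * t) * t ^ p * besselK ν t)) := by
  have h := (aecover_Ioi_of_Ioi (μ := volume) tendsto_id_nhdsGT_zero
    ).integral_tendsto_of_countably_generated (integrableOn_exp_mul_rpow_mul_besselK hν hp hβ)
  refine h.congr' ?_
  filter_upwards [self_mem_nhdsWithin] with x hx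
  rw [Measure.restrict_restrict measurableSet_Ioi,
    inter_eq_left.2 (Ioi_subset_Ioi (le_of_lt hx))]

theorem integral_tail_succ {ν β x : ℝ} (hν : -1 / 2 < ν) (hβ : β < 1) (hx : 0 < x) :
    ∫ t in Ioi x, Real.exp (β * t) * t ^ (ν + 1) * besselK ν t =
      Real.exp (β * x) * x ^ (ν + 1) * besselK (ν + 1) x +
      β * ∫ t in Ioi x, Real.exp (β * t) * t ^ (ν + 1) * besselK (ν + 1) t := by
  have hi1 := (integrableOn_tail (p := ν + 1) (x := x) (by linarith : -1 / 2 < ν + 1) le_rfl hβ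
    hx.le).const_mul β
  have hi2 := integrableOn_tail (p := ν + 1) hν (by linarith) hβ hx.le
  have key := integral_Ioi_of_hasDerivAt_of_tendsto' (a := x) (m := 0)
    (f := fun t : ℝ => Real.exp (β * t) * t ^ (ν + 1) * besselK (ν + 1) t)
    (f' := fun t : ℝ => β * (Real.exp (β * t) * t ^ (ν + 1) * besselK (ν + 1) t) -
      Real.exp (β * t) * t ^ (ν + 1) * besselK ν t) (fun t ht => ?_) (hi1.sub hi2)
    (tendsto_exp_mul_rpow_mul_besselK (ν + 1) (ν + 1) hβ)
  · rw [integral_sub hi1 hi2, integral_const_mul] at key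
    linarith
  · have ht0 : 0 < t := hx.trans_le ht
    have h1 : HasDerivAt (fun t : ℝ => Real.exp (β * t)) (Real.exp (β * t) * β) t := by
      simpa using ((hasDerivAt_id t).const_mul β).exp
    simp only [mul_assoc]
    refine (h1.mul (hasDerivAt_rpow_mul_besselK ν ht0)).congr_deriv ?_
    ring

theorem integral_zero_succ {ν β : ℝ} (hν : -1 / 2 < ν) (hβ : β < 1) :
    ∫ t in Ioi 0, Real.exp (β * t) * t ^ (ν + 1) * besselK ν t =
      2 ^ ν * Real.Gamma (ν + 1) +
      β * ∫ t in Ioi 0, Real.exp (β * t) * t ^ (ν + 1) * besselK (ν + 1) t := by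
  refine tendsto_nhds_unique (tendsto_integral_tail hν (by linarith) hβ) ?_
  have h1 := tendsto_rpow_mul_besselK_nhdsGT_zero (m := ν + 1) (by linarith)
  rw [add_sub_cancel_right] at h1
  have h2 : Tendsto (fun x : ℝ => Real.exp (β * x)) (𝓝[>] 0) (𝓝 1) := by
    have h3 : Continuous fun x : ℝ => Real.exp (β * x) := by fun_prop
    simpa using (h3.tendsto 0).mono_left nhdsWithin_le_nhds
  have h4 := (h2.mul h1).add ((tendsto_integral_tail (p := ν + 1)
    (by linarith : -1 / 2 < ν + 1) le_rfl hβ).const_mul β)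
  rw [one_mul] at h4
  refine h4.congr' ?_
  filter_upwards [self_mem_nhdsWithin] with x hx
  rw [integral_tail_succ hν hβ hx, mul_assoc (Real.exp (β * x))]

/-- Translate the tail to $(0,\infty)$ by $t=x+s$. Submultiplicativity factors out the value at $x$,
and the Laplace transform bounds what remains. -/
theorem integral_tail_lt {μ β x : ℝ} (hμ : -1 / 2 < μ) (hβ : β < 1) (hβ0 : 0 < β) (hx : 0 < x) :
    ∫ t in Ioi x, Real.exp (β * t) * t ^ (μ + 1) * besselK (μ + 1) t <
      Real.exp (β * x) * x ^ (μ + 1) * besselK (μ + 1) x *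
      (2 * √π * Real.Gamma (μ + 3 / 2) / ((1 - β ^ 2) ^ (μ + 3 / 2) * Real.Gamma (μ + 1))) := by
  have hμ1 : -1 / 2 < μ + 1 := by linarith
  have hc0 : 0 < (2 : ℝ) ^ μ * Real.Gamma (μ + 1) :=
    mul_pos (Real.rpow_pos_of_pos two_pos _) (Real.Gamma_pos_of_pos (by linarith))
  set f : ℝ → ℝ := fun t => Real.exp (β * t) * t ^ (μ + 1) * besselK (μ + 1) t with hf
  have hβ2 : β ^ 2 < 1 := by nlinarith
  have hM := integral_exp_mul_rpow_mul_besselK_lt (m := μ + 1) (by linarith) hβ2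
  have hfx : 0 < f x := by
    have := besselK_pos (μ + 1) hx
    simp only [hf]
    positivity
  have hemb : MeasurableEmbedding (fun s : ℝ => x + s) := measurableEmbedding_addLeft x
  have hpre : (fun s : ℝ => x + s) ⁻¹' Ioi x = Ioi 0 := by
    ext s; simp
  have hmp := measurePreserving_add_left (volume : Measure ℝ) x
  have hshift := hmp.setIntegral_preimage_emb hemb f (Ioi x)
  have hshift_int := (hmp.integrableOn_comp_preimage hemb (f := f) (s := Ioi x)).2
    (integrableOn_tail hμ1 le_rfl hβ hx.le)
  rw [hpre] at hshift hshift_int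
  have hle : (∫ t in Ioi x, f t) * (2 ^ μ * Real.Gamma (μ + 1)) ≤ f x * ∫ s in Ioi 0, f s := by
    rw [← hshift, ← integral_mul_const, ← integral_const_mul]
    refine setIntegral_mono_on (hshift_int.mul_const _)
      ((integrableOn_exp_mul_rpow_mul_besselK hμ1 le_rfl hβ).const_mul _) measurableSet_Ioi
      fun s hs => ?_
    have h1 := mul_le_mul_of_nonneg_left (rpow_mul_besselK_add_le hμ hx hs)
      (Real.exp_pos (β * (x + s))).le
    have h2 : Real.exp (β * (x + s)) = Real.exp (β * x) * Real.exp (β * s) := by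
      rw [mul_add, Real.exp_add]
    simp only [hf]
    calc _ = Real.exp (β * (x + s)) * ((x + s) ^ (μ + 1) * besselK (μ + 1) (x + s) *
          (2 ^ μ * Real.Gamma (μ + 1))) := by ring
      _ ≤ _ := h1
      _ = _ := by rw [h2]; ring
  have hlt : (∫ t in Ioi x, f t) * (2 ^ μ * Real.Gamma (μ + 1)) < f x *
      (2 ^ (μ + 1) * √π * Real.Gamma (μ + 1 + 1 / 2) / (1 - β ^ 2) ^ (μ + 1 + 1 / 2)) :=
    hle.trans_lt (mul_lt_mul_of_pos_left hM hfx)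
  rw [← lt_div_iff₀ hc0] at hlt
  refine hlt.trans_eq ?_
  have hG := (Real.Gamma_pos_of_pos (by linarith : 0 < μ + 1)).ne'
  have h2 := (Real.rpow_pos_of_pos (by linarith : 0 < 1 - β ^ 2) (μ + 3 / 2)).ne'
  have h3 := (Real.rpow_pos_of_pos two_pos μ).ne'
  rw [show μ + 1 + 1 / 2 = μ + 3 / 2 by ring, Real.rpow_add_one two_ne_zero]
  simp only [hf]
  field_simp

theorem integral_zero_lt {μ β : ℝ} (hμ : -1 / 2 < μ) (hβ : β ^ 2 < 1) :
    ∫ t in Ioi 0, Real.exp (β * t) * t ^ (μ + 1) * besselK (μ + 1) t <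
      2 ^ μ * Real.Gamma (μ + 1) *
      (2 * √π * Real.Gamma (μ + 3 / 2) / ((1 - β ^ 2) ^ (μ + 3 / 2) * Real.Gamma (μ + 1))) := by
  refine (integral_exp_mul_rpow_mul_besselK_lt (m := μ + 1) (by linarith) hβ).trans_eq ?_
  have hG := (Real.Gamma_pos_of_pos (by linarith : 0 < μ + 1)).ne'
  rw [show μ + 1 + 1 / 2 = μ + 3 / 2 by ring, Real.rpow_add_one two_ne_zero]
  field_simp

/-! ### Hyperbolic functions and the Langevin function. -/

theorem sinh_le_mul_cosh {x : ℝ} (hx : 0 < x) : Real.sinh x ≤ x * Real.cosh x := by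
  have h := nonneg_of_deriv_nonneg_of_tendsto_zero
    (f := fun x => x * Real.cosh x - Real.sinh x) (f' := fun x => x * Real.sinh x)
    (fun y _ => (((hasDerivAt_id y).mul (Real.hasDerivAt_cosh y)).sub
      (Real.hasDerivAt_sinh y)).congr_deriv (by simp only [id]; ring))
    (fun y hy => mul_nonneg hy.le (Real.sinh_nonneg_iff.2 hy.le)) ?_ hx
  · linarith
  · have hc : Continuous fun x : ℝ => x * Real.cosh x - Real.sinh x := by fun_prop
    simpa using (hc.tendsto 0).mono_left nhdsWithin_le_nhds

/-- This is $x\coth x-1\ge x^2/(3+x^2/5)$, a convergent of the continued fraction of $x\coth x$.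
Differentiating twice, with powers of $x$ split off, reduces it to $\sinh x\le x\cosh x$. -/
theorem mul_cosh_sub_sinh_ge {x : ℝ} (hx : 0 < x) :
    5 * x ^ 2 * Real.sinh x ≤ (15 + x ^ 2) * (x * Real.cosh x - Real.sinh x) := by
  have h1 : ∀ y : ℝ, 0 < y →
      0 ≤ y ^ 2 * Real.sinh y + 3 * Real.sinh y - 3 * y * Real.cosh y := by
    intro y hy
    refine nonneg_of_deriv_nonneg_of_tendsto_zero
      (f := fun y => y ^ 2 * Real.sinh y + 3 * Real.sinh y - 3 * y * Real.cosh y)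
      (f' := fun y => y * (y * Real.cosh y - Real.sinh y))
      (fun t _ => ((((hasDerivAt_pow 2 t).mul (Real.hasDerivAt_sinh t)).add
        ((Real.hasDerivAt_sinh t).const_mul 3)).sub
        (((hasDerivAt_id t).const_mul 3).mul (Real.hasDerivAt_cosh t))).congr_deriv
        (by simp only [id]; push_cast; ring))
      (fun t ht => mul_nonneg ht.le (sub_nonneg.2 (sinh_le_mul_cosh ht))) ?_ hy
    have hc : Continuous fun y : ℝ =>
        y ^ 2 * Real.sinh y + 3 * Real.sinh y - 3 * y * Real.cosh y := by fun_prop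
    simpa using (hc.tendsto 0).mono_left nhdsWithin_le_nhds
  have h2 := nonneg_of_deriv_nonneg_of_tendsto_zero
    (f := fun y => (15 * y + y ^ 3) * Real.cosh y - (15 + 6 * y ^ 2) * Real.sinh y)
    (f' := fun y => y * (y ^ 2 * Real.sinh y + 3 * Real.sinh y - 3 * y * Real.cosh y))
    (fun t _ => (((((hasDerivAt_id t).const_mul 15).add (hasDerivAt_pow 3 t)).mul
      (Real.hasDerivAt_cosh t)).sub ((((hasDerivAt_pow 2 t).const_mul 6).const_add 15).mul
      (Real.hasDerivAt_sinh t))).congr_deriv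
        (by simp only [id, Pi.add_apply]; push_cast; ring))
    (fun t ht => mul_nonneg ht.le (h1 t ht)) ?_ hx
  · linarith
  · have hc : Continuous fun y : ℝ =>
        (15 * y + y ^ 3) * Real.cosh y - (15 + 6 * y ^ 2) * Real.sinh y := by fun_prop
    simpa using (hc.tendsto 0).mono_left nhdsWithin_le_nhds

/-- The Langevin function `coth x - 1/x`. -/
noncomputable def langevin (x : ℝ) : ℝ := Real.cosh x / Real.sinh x - 1 / x

theorem mul_coth_sub_eq {x : ℝ} (hx : 0 < x) :
    x * (Real.cosh x / Real.sinh x - 1) = 2 * x / (Real.exp (2 * x) - 1) := by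
  have hs := Real.sinh_pos_iff.2 hx
  have he : 0 < Real.exp (2 * x) - 1 := by
    have := Real.one_lt_exp_iff.2 (by linarith : 0 < 2 * x)
    linarith
  rw [div_sub_one hs.ne', mul_div_assoc', div_eq_div_iff hs.ne' he.ne', Real.cosh_sub_sinh]
  rw [Real.sinh_eq, two_mul x, Real.exp_add, Real.exp_neg]
  have := Real.exp_pos x
  field_simp
  norm_num

theorem one_lt_coth {x : ℝ} (hx : 0 < x) : 1 < Real.cosh x / Real.sinh x := by
  rw [one_lt_div (Real.sinh_pos_iff.2 hx)]
  exact Real.sinh_lt_cosh x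

theorem langevin_nonneg {x : ℝ} (hx : 0 < x) : 0 ≤ langevin x := by
  have hs := Real.sinh_pos_iff.2 hx
  rw [langevin, sub_nonneg, div_le_div_iff₀ hx hs]
  linarith [sinh_le_mul_cosh hx]

theorem langevin_le_one {x : ℝ} (hx : 0 < x) : langevin x ≤ 1 := by
  have h := mul_coth_sub_eq hx
  have he := Real.add_one_le_exp (2 * x)
  have h1 : 2 * x / (Real.exp (2 * x) - 1) ≤ 1 := by
    rw [div_le_one (by linarith)]
    linarith
  rw [← h] at h1
  rw [langevin]
  have h2 : x * (Real.cosh x / Real.sinh x - 1 / x) ≤ x * 1 := by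
    rw [mul_sub, mul_one_div_cancel hx.ne']
    linarith
  exact le_of_mul_le_mul_left h2 hx

theorem hasDerivAt_langevin {x : ℝ} (hx : 0 < x) :
    HasDerivAt langevin (1 - 2 / x * langevin x - langevin x ^ 2) x := by
  have hs := Real.sinh_pos_iff.2 hx
  have h1 := ((Real.hasDerivAt_cosh x).div (Real.hasDerivAt_sinh x) hs.ne').sub
    ((hasDerivAt_const x (1 : ℝ)).div (hasDerivAt_id x) hx.ne')
  refine h1.congr_deriv ?_
  simp only [langevin, id]
  field_simp
  ring

/-! ### Elementary bounds for the Bessel ratios when $\nu\le\frac12$. -/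

/-- $L$ satisfies the Riccati equation of $I_{\nu+1}/I_\nu$ at $\nu=\frac12$; for smaller $\nu$ the
defect is $(1-2\nu)L/x\ge0$. The integrating factor $x^\nu\sinh x$ turns this into a monotonicity
statement. -/
theorem langevin_mul_besselI_le {ν x : ℝ} (hν : -1 / 2 < ν) (hν2 : ν ≤ 1 / 2) (hx : 0 < x) :
    langevin x * besselI ν x ≤ besselI (ν + 1) x := by
  have hν1 : -1 < ν := by linarith
  have key := nonneg_of_deriv_nonneg_of_tendsto_zero
    (f := fun x => Real.sinh x * x ^ ν * (besselI (ν + 1) x - langevin x * besselI ν x))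
    (f' := fun x => (1 - 2 * ν) * (Real.sinh x * x ^ ν * (langevin x / x * besselI ν x)))
    ?_ ?_ ?_ hx
  · have h1 : 0 < Real.sinh x * x ^ ν :=
      mul_pos (Real.sinh_pos_iff.2 hx) (Real.rpow_pos_of_pos hx ν)
    have h2 := nonneg_of_mul_nonneg_right key h1
    linarith
  · intro y hy
    have hs := Real.sinh_pos_iff.2 hy
    refine (((Real.hasDerivAt_sinh y).mul (Real.hasDerivAt_rpow_const (p := ν)
      (Or.inl hy.ne'))).mul ((hasDerivAt_besselI_succ hν1 hy).sub ((hasDerivAt_langevin hy).mul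
      (hasDerivAt_besselI ν hy)))).congr_deriv ?_
    have hc : Real.cosh y = (langevin y + 1 / y) * Real.sinh y := by
      rw [langevin]
      field_simp
      ring
    simp only [Pi.mul_apply, Pi.sub_apply]
    rw [hc, Real.rpow_sub_one hy.ne']
    field_simp
    ring
  · intro y hy
    have h1 := langevin_nonneg hy
    have h2 := besselI_pos hν1 hy
    have h3 := Real.sinh_pos_iff.2 hy
    have h4 : 0 ≤ 1 - 2 * ν := by linarith
    positivity
  · have hs : Tendsto Real.sinh (𝓝[>] 0) (𝓝 0) := by
      simpa using (Real.continuous_sinh.tendsto 0).mono_left nhdsWithin_le_nhds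
    have hc : Tendsto Real.cosh (𝓝[>] 0) (𝓝 1) := by
      simpa using (Real.continuous_cosh.tendsto 0).mono_left nhdsWithin_le_nhds
    have h1 := hs.mul (tendsto_besselI_div_rpow_zero (μ := ν + 1) (a := -ν) (by linarith))
    have h2 := hc.mul (tendsto_besselI_div_rpow_zero (μ := ν) (a := -(ν + 1)) (by linarith))
    have h3 : Tendsto (fun x => Real.sinh x * x ^ ν * (langevin x * besselI ν x)) (𝓝[>] 0)
        (𝓝 0) := by
      rw [mul_zero] at h2
      refine squeeze_zero' ?_ ?_ h2 <;> filter_upwards [self_mem_nhdsWithin] with y hy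
      · have hy : 0 < y := hy
        have h1 := langevin_nonneg hy
        have h2 := besselI_pos hν1 hy
        have h3 := Real.sinh_pos_iff.2 hy
        positivity
      · have hy : 0 < y := hy
        have h1 := langevin_nonneg hy
        have h2 := besselI_pos hν1 hy
        have h3 := Real.sinh_pos_iff.2 hy
        have h4 := Real.rpow_pos_of_pos hy ν
        have h5 := Real.cosh_pos y
        rw [Real.rpow_neg hy.le, div_inv_eq_mul, Real.rpow_add_one hy.ne']
        calc Real.sinh y * y ^ ν * (langevin y * besselI ν y)
            ≤ (y * Real.cosh y) * y ^ ν * (1 * besselI ν y) := by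
              gcongr
              · exact sinh_le_mul_cosh hy
              · exact langevin_le_one hy
          _ = _ := by ring
    have h4 := h1.sub h3
    rw [mul_zero, sub_zero] at h4
    refine h4.congr' ?_
    filter_upwards [self_mem_nhdsWithin] with y hy
    have hy : 0 < y := hy
    rw [Real.rpow_neg hy.le, div_inv_eq_mul]
    ring

/-- The ratio $r=K_{\nu+1}/K_\nu$ solves $r'=r^2-2ar/x-1$ with $a=\nu+\frac12$. The shift
$d=(1-2\nu)/4$ makes $1+a/(x+d)$ agree with $r$ through order $x^{-2}$ at infinity, and leaves a
Riccati defect of one sign, $-2ad(a+d)/(x(x+d)^2)$. The comparison runs inwards from infinity. -/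
theorem besselK_succ_ge {ν x : ℝ} (hν : -1 / 2 < ν) (hν2 : ν ≤ 1 / 2) (hx : 0 < x) :
    (1 + (ν + 1 / 2) / (x + (1 - 2 * ν) / 4)) * besselK ν x ≤ besselK (ν + 1) x := by
  set a : ℝ := ν + 1 / 2 with ha
  set d : ℝ := (1 - 2 * ν) / 4 with hd
  have ha0 : 0 < a := by linarith
  have hd0 : 0 ≤ d := by linarith
  have key := nonneg_of_deriv_nonpos_of_tendsto_atTop
    (f := fun x => (x + d) ^ (-a) * Real.exp (-x) * (x ^ (ν + 1) * (besselK (ν + 1) x -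
      (1 + a / (x + d)) * besselK ν x)))
    (f' := fun x => (x + d) ^ (-a) * Real.exp (-x) * (x ^ (ν + 1) * (besselK ν x *
      ((1 + a / (x + d)) ^ 2 - 2 * a / x * (1 + a / (x + d)) - 1 + a / (x + d) ^ 2))))
    ?_ ?_ ?_ hx
  · have h1 : 0 < (x + d) ^ (-a) * Real.exp (-x) :=
      mul_pos (Real.rpow_pos_of_pos (by linarith) _) (Real.exp_pos _)
    have h2 := nonneg_of_mul_nonneg_right (nonneg_of_mul_nonneg_right key h1)
      (Real.rpow_pos_of_pos hx _)
    linarith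
  · intro y hy
    have hyd : 0 < y + d := by linarith
    have e1 : HasDerivAt (fun y : ℝ => (y + d) ^ (-a)) (-a * (y + d) ^ (-a - 1)) y := by
      simpa using ((hasDerivAt_id y).add_const d).rpow_const (p := -a) (Or.inl hyd.ne')
    have e2 : HasDerivAt (fun y : ℝ => Real.exp (-y)) (-Real.exp (-y)) y := by
      simpa using (hasDerivAt_id y).neg.exp
    have e3 : HasDerivAt (fun y : ℝ => 1 + a / (y + d)) (-a / (y + d) ^ 2) y := by
      simpa using (((hasDerivAt_const y a).div ((hasDerivAt_id y).add_const d)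
        hyd.ne').const_add 1)
    refine ((e1.mul e2).mul ((Real.hasDerivAt_rpow_const (Or.inl hy.ne')).mul
      ((hasDerivAt_besselK_succ ν hy).sub (e3.mul (hasDerivAt_besselK ν hy))))).congr_deriv ?_
    simp only [Pi.mul_apply, Pi.sub_apply]
    rw [add_sub_cancel_right, Real.rpow_add_one hy.ne', Real.rpow_sub_one hyd.ne']
    have hν' : ν = a - 1 / 2 := by rw [ha]; ring
    generalize (y + d) ^ (-a) = p1
    generalize y ^ ν = p2
    generalize besselK (ν + 1) y = l
    generalize besselK ν y = k
    rw [hν']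
    field_simp
    ring
  · intro y hy
    have hyd : 0 < y + d := by linarith
    have h1 := besselK_pos ν hy
    have h2 : (1 + a / (y + d)) ^ 2 - 2 * a / y * (1 + a / (y + d)) - 1 + a / (y + d) ^ 2 =
        -(2 * a * d * (d + a)) / (y * (y + d) ^ 2) := by
      have hda : a = 1 - 2 * d := by rw [ha, hd]; ring
      rw [hda]
      field_simp
      ring
    rw [h2]
    have h3 : 0 ≤ (2 * a * d * (d + a)) / (y * (y + d) ^ 2) := by positivity
    have h4 : 0 ≤ (y + d) ^ (-a) * Real.exp (-y) :=
      (mul_pos (Real.rpow_pos_of_pos hyd _) (Real.exp_pos _)).le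
    refine mul_nonpos_of_nonneg_of_nonpos h4 (mul_nonpos_of_nonneg_of_nonpos
      (Real.rpow_pos_of_pos hy _).le (mul_nonpos_of_nonneg_of_nonpos h1.le ?_))
    rw [neg_div]
    linarith
  · have hid : Tendsto (fun y : ℝ => y + d) atTop atTop :=
      tendsto_atTop_add_const_right _ _ tendsto_id
    have h1 := (tendsto_rpow_neg_atTop ha0).comp hid
    have h2 : Tendsto (fun y : ℝ => a / (y + d)) atTop (𝓝 0) := hid.const_div_atTop a
    have h3 := (h1.mul Real.tendsto_exp_neg_atTop_nhds_zero).mul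
      ((tendsto_rpow_mul_besselK (ν + 1) (ν + 1)).sub
        ((h2.const_add 1).mul (tendsto_rpow_mul_besselK ν (ν + 1))))
    simp only [mul_zero, sub_zero] at h3
    refine h3.congr fun y => ?_
    simp only [Function.comp]
    ring

/-! ### The elementary inequality for $\coth$. -/

theorem coth_polynomial_mono {x h D D' : ℝ} (hx : 0 < x) (h0 : 0 ≤ h) (hD' : D' ≤ D)
    (hD0 : 0 ≤ D') (hD1 : 1 - x ≤ D') :
    2 * x * D' ^ 2 + 6 * x ^ 2 * D' + h * (D' ^ 2 + 5 * x * D' + 2 * x ^ 2 - 5 * x - D') +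
      2 * h ^ 2 * (x + D' - 1) ≤
    2 * x * D ^ 2 + 6 * x ^ 2 * D + h * (D ^ 2 + 5 * x * D + 2 * x ^ 2 - 5 * x - D) +
      2 * h ^ 2 * (x + D - 1) := by
  have h1 : 0 ≤ 2 * x * (D + D') + 6 * x ^ 2 + h * (D + D' + 5 * x - 1) + 2 * h ^ 2 := by
    have : 0 ≤ D + D' + 5 * x - 1 := by linarith
    have : 0 ≤ D := hD0.trans hD'
    positivity
  have h2 := mul_nonneg (sub_nonneg.2 hD') h1
  linarith

/-- The numerator of `coth_ratio_inequality` for $D=x(\coth x-1)$. By monotonicity $D$ may be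
replaced by a lower bound: the continued-fraction one for $x\le2$, the constant $\frac1{37}$ on
$[2,\frac52]$. For $x\ge\frac52$ the term $2x^2-5x$ is already nonnegative. -/
theorem coth_polynomial_nonneg {x h D : ℝ} (hx : 0 < x) (h0 : 0 ≤ h) (h1 : h ≤ 1) (hD0 : 0 ≤ D)
    (hD1 : 1 - x + 5 * x ^ 2 / (15 + x ^ 2) ≤ D) (hD2 : 2 ≤ x → x ≤ 5 / 2 → 1 / 37 ≤ D)
    (hD3 : 1 ≤ x + D) :
    0 ≤ 2 * x * D ^ 2 + 6 * x ^ 2 * D + h * (D ^ 2 + 5 * x * D + 2 * x ^ 2 - 5 * x - D) +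
      2 * h ^ 2 * (x + D - 1) := by
  rcases le_total x 2 with hx2 | hx2
  · have hn : 0 < 15 + x ^ 2 := by positivity
    have hA : 1 - x + 5 * x ^ 2 / (15 + x ^ 2) =
        (15 - 15 * x + 6 * x ^ 2 - x ^ 3) / (15 + x ^ 2) := by
      field_simp
      ring
    have hA0 : 0 ≤ 1 - x + 5 * x ^ 2 / (15 + x ^ 2) := by
      rw [hA]
      refine div_nonneg ?_ hn.le
      nlinarith [mul_nonneg hx.le (sq_nonneg (x - 2)), sq_nonneg (x - 2)]
    have hu : 0 ≤ 5 * x ^ 2 / (15 + x ^ 2) := by positivity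
    refine le_trans ?_ (coth_polynomial_mono hx h0 hD1 hA0 (by linarith))
    have hP : 2 * x * (1 - x + 5 * x ^ 2 / (15 + x ^ 2)) ^ 2 +
        6 * x ^ 2 * (1 - x + 5 * x ^ 2 / (15 + x ^ 2)) +
        h * ((1 - x + 5 * x ^ 2 / (15 + x ^ 2)) ^ 2 +
          5 * x * (1 - x + 5 * x ^ 2 / (15 + x ^ 2)) + 2 * x ^ 2 - 5 * x -
          (1 - x + 5 * x ^ 2 / (15 + x ^ 2))) +
        2 * h ^ 2 * (x + (1 - x + 5 * x ^ 2 / (15 + x ^ 2)) - 1) =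
        x * (450 + 450 * x - 540 * x ^ 2 + 210 * x ^ 3 - 48 * x ^ 4 + 12 * x ^ 5 - 4 * x ^ 6 +
          h * (-225 - 375 * x + 195 * x ^ 2 - 30 * x ^ 3 + 14 * x ^ 4 - 2 * x ^ 5) +
          h ^ 2 * (150 * x + 10 * x ^ 3)) / (15 + x ^ 2) ^ 2 := by
      field_simp
      ring
    rw [hP]
    refine div_nonneg (mul_nonneg hx.le ?_) (by positivity)
    have hq : 0 ≤ 150 * x + 10 * x ^ 3 := by positivity
    -- The bracket is a convex quadratic in $h$. Replace $h^2$ by its tangent at $h=1$ (here) or at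
    -- $h=\frac12$ (for $x\ge\frac32$); the result is affine in $h$, and `e0`, `e1` are its values
    -- at $h=0$ and $h=1$.
    rcases le_total x (3 / 2) with hx3 | hx3
    · have e0 : 0 ≤ 450 + 300 * x - 540 * x ^ 2 + 200 * x ^ 3 - 48 * x ^ 4 + 12 * x ^ 5 -
          4 * x ^ 6 := by
        have hz : 0 ≤ 3 / 2 - x := by linarith
        nlinarith [mul_nonneg hx.le hz, pow_pos hx 2, pow_pos hx 3, pow_pos hx 4, pow_pos hx 5,
          mul_nonneg (pow_pos hx 2).le hz, mul_nonneg (pow_pos hx 3).le hz,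
          mul_nonneg (pow_pos hx 4).le hz, mul_nonneg (pow_pos hx 5).le hz]
      have e1 : 0 ≤ 225 + 225 * x - 345 * x ^ 2 + 190 * x ^ 3 - 34 * x ^ 4 + 10 * x ^ 5 -
          4 * x ^ 6 := by
        have hz : 0 ≤ 3 / 2 - x := by linarith
        nlinarith [mul_nonneg hx.le hz, pow_pos hx 2, pow_pos hx 3, pow_pos hx 4, pow_pos hx 5,
          mul_nonneg (pow_pos hx 2).le hz, mul_nonneg (pow_pos hx 3).le hz,
          mul_nonneg (pow_pos hx 4).le hz, mul_nonneg (pow_pos hx 5).le hz, mul_nonneg hx.le (sq_nonneg (x - 1)),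
          sq_nonneg (x - 1)]
      linarith [mul_nonneg (sub_nonneg.2 h1) e0, mul_nonneg h0 e1,
        mul_nonneg hq (sq_nonneg (h - 1))]
    · have e0 : 0 ≤ 450 + 825 / 2 * x - 540 * x ^ 2 + 415 / 2 * x ^ 3 - 48 * x ^ 4 +
          12 * x ^ 5 - 4 * x ^ 6 := by
        obtain ⟨z, rfl⟩ : ∃ z, x = 2 - z := ⟨2 - x, by ring⟩
        have hz : 0 ≤ z := by linarith
        have hz2 : 0 ≤ 1 / 2 - z := by linarith
        nlinarith [mul_nonneg hz hz2, mul_nonneg (pow_nonneg hz 2) hz2,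
          mul_nonneg (pow_nonneg hz 3) hz2, mul_nonneg (pow_nonneg hz 4) hz2,
          mul_nonneg (pow_nonneg hz 5) hz2, pow_nonneg hz 2, pow_nonneg hz 3, pow_nonneg hz 4,
          pow_nonneg hz 5]
      have e1 : 0 ≤ 225 + 375 / 2 * x - 345 * x ^ 2 + 375 / 2 * x ^ 3 - 34 * x ^ 4 +
          10 * x ^ 5 - 4 * x ^ 6 := by
        obtain ⟨z, rfl⟩ : ∃ z, x = 2 - z := ⟨2 - x, by ring⟩
        have hz : 0 ≤ z := by linarith
        have hz2 : 0 ≤ 1 / 2 - z := by linarith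
        nlinarith [mul_nonneg hz hz2, mul_nonneg (pow_nonneg hz 2) hz2,
          mul_nonneg (pow_nonneg hz 3) hz2, mul_nonneg (pow_nonneg hz 4) hz2,
          mul_nonneg (pow_nonneg hz 5) hz2, pow_nonneg hz 2, pow_nonneg hz 3, pow_nonneg hz 4,
          pow_nonneg hz 5]
      linarith [mul_nonneg (sub_nonneg.2 h1) e0, mul_nonneg h0 e1,
        mul_nonneg hq (sq_nonneg (h - 1 / 2))]
  · have hmain : ∀ {D : ℝ}, 0 ≤ D → 0 ≤ D ^ 2 + 5 * x * D - D := fun {D} hD => by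
      have := mul_nonneg hD (by linarith : 0 ≤ D + 5 * x - 1)
      linarith
    rcases le_total x (5 / 2) with hx3 | hx3
    · refine le_trans ?_ (coth_polynomial_mono hx h0 (hD2 hx2 hx3) (by norm_num) (by linarith))
      -- $\frac37$ is close to the minimiser in $h$ at $x=2$, $D=\frac1{37}$.
      nlinarith [mul_nonneg h0 (mul_nonneg (sub_nonneg.2 hx2) (by linarith : 0 ≤ 2 * x - 1)),
        mul_nonneg h0 (sub_nonneg.2 hx2), mul_nonneg (sub_nonneg.2 hx2) (sub_nonneg.2 hx2),
        mul_nonneg (sq_nonneg h) (sub_nonneg.2 hx2), sq_nonneg (h - 3 / 7)]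
    · have e1 : 0 ≤ x * (2 * x - 5) := mul_nonneg hx.le (by linarith)
      have e2 : 0 ≤ D ^ 2 + 5 * x * D + 2 * x ^ 2 - 5 * x - D := by
        have := hmain hD0
        linarith
      have e3 : 0 ≤ x + D - 1 := by linarith
      positivity

theorem exp_five_lt : Real.exp 5 < 149 := by
  have h : Real.exp 5 = Real.exp 1 ^ 5 := by
    rw [← Real.exp_nat_mul]
    norm_num
  rw [h]
  calc Real.exp 1 ^ 5 < 2.7182818286 ^ 5 := by
        gcongr
        exact Real.exp_one_lt_d9
    _ < 149 := by norm_num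

/-- Used with $h=\frac12-\nu$: it is the $\beta=0$ case of the differential inequality behind
`integral_tail_lt_of_le_half`, with $K_{\nu+1}/K_\nu$ replaced by its rational lower bound. -/
theorem coth_ratio_inequality {x h : ℝ} (hx : 0 < x) (h0 : 0 ≤ h) (h1 : h ≤ 1) :
    2 ≤ (1 + (1 - h) / (x + h / 2)) * (Real.cosh x / Real.sinh x) +
      langevin x * (langevin x + (1 + 2 * h) / x) := by
  set D : ℝ := x * (Real.cosh x / Real.sinh x - 1) with hD
  have hs := Real.sinh_pos_iff.2 hx
  have hD0 : 0 ≤ D := mul_nonneg hx.le (by linarith [one_lt_coth hx])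
  have hC : Real.cosh x / Real.sinh x = (x + D) / x := by
    rw [hD]; field_simp; ring
  have hL : langevin x = (x + D - 1) / x := by
    rw [langevin, hC]; ring
  have hD3 : 1 ≤ x + D := by
    have h2 := langevin_nonneg hx
    rw [hL] at h2
    have := mul_nonneg h2 hx.le
    rw [div_mul_cancel₀ _ hx.ne'] at this
    linarith
  have hD1 : 1 - x + 5 * x ^ 2 / (15 + x ^ 2) ≤ D := by
    have h2 := mul_cosh_sub_sinh_ge hx
    have h3 : 5 * x ^ 2 / (15 + x ^ 2) ≤ (x * Real.cosh x - Real.sinh x) / Real.sinh x := by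
      rw [div_le_div_iff₀ (by positivity) hs]
      linarith
    have h4 : D = 1 - x + (x * Real.cosh x - Real.sinh x) / Real.sinh x := by
      rw [hD]; field_simp; ring
    linarith
  -- $D=2x/(e^{2x}-1)\ge4/(e^5-1)$, and $e^5<149$ makes this at least $4/148$.
  have hD2 : 2 ≤ x → x ≤ 5 / 2 → 1 / 37 ≤ D := by
    intro hx2 hx3
    have he : 0 < Real.exp (2 * x) - 1 := by
      have := Real.add_one_le_exp (2 * x)
      linarith
    have he2 : Real.exp (2 * x) ≤ Real.exp 5 := Real.exp_le_exp.2 (by linarith)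
    have he3 := exp_five_lt
    rw [hD, mul_coth_sub_eq hx, div_le_div_iff₀ (by norm_num) he]
    linarith
  have hF := coth_polynomial_nonneg hx h0 h1 hD0 hD1 hD2 hD3
  have hxh : 0 < 2 * x + h := by linarith
  have heq : (1 + (1 - h) / (x + h / 2)) * (Real.cosh x / Real.sinh x) +
      langevin x * (langevin x + (1 + 2 * h) / x) - 2 =
      (2 * x * D ^ 2 + 6 * x ^ 2 * D + h * (D ^ 2 + 5 * x * D + 2 * x ^ 2 - 5 * x - D) +
      2 * h ^ 2 * (x + D - 1)) / (x ^ 2 * (2 * x + h)) := by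
    rw [hC, hL, show x + h / 2 = (2 * x + h) / 2 by ring]
    field_simp
    ring
  have h2 := div_nonneg hF (by positivity : 0 ≤ x ^ 2 * (2 * x + h))
  rw [← heq] at h2
  linarith

/-! ### The tail bound for $\nu\le\frac12$ and $0<\beta<1$. -/

/-- The right side `C` vanishes at infinity and $-C'=e^{\beta t}t^\nu R$, so $R>2(1-\beta)K_\nu$
suffices. Both sides are affine in $\beta$: the claim is $1-\beta$ times the case $\beta=0$ (`e0`)
plus $\beta$ times the case $\beta=1$ (`e1`, strict). -/
theorem integral_tail_lt_of_le_half {ν β x : ℝ} (hν : -1 / 2 < ν) (hν2 : ν ≤ 1 / 2)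
    (hβ0 : 0 < β) (hβ : β < 1) (hx : 0 < x) :
    2 * (1 - β) * ∫ t in Ioi x, Real.exp (β * t) * t ^ ν * besselK ν t <
      Real.exp (β * x) * x ^ ν * (besselK (ν + 1) x + langevin x * besselK ν x) := by
  set C : ℝ → ℝ := fun t =>
    Real.exp (β * t) * t ^ ν * (besselK (ν + 1) t + langevin t * besselK ν t) with hCdef
  set R : ℝ → ℝ := fun t => besselK (ν + 1) t * (langevin t + 1 / t) +
    besselK ν t * (langevin t ^ 2 + (2 - 2 * ν) / t * langevin t) -
    β * (besselK (ν + 1) t + langevin t * besselK ν t) with hR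
  have hderiv : ∀ t, 0 < t → HasDerivAt C (-(Real.exp (β * t) * t ^ ν * R t)) t := by
    intro t ht
    have h1 : HasDerivAt (fun t : ℝ => Real.exp (β * t)) (Real.exp (β * t) * β) t := by
      simpa using ((hasDerivAt_id t).const_mul β).exp
    refine ((h1.mul (Real.hasDerivAt_rpow_const (Or.inl ht.ne'))).mul
      ((hasDerivAt_besselK_succ ν ht).add ((hasDerivAt_langevin ht).mul
        (hasDerivAt_besselK ν ht)))).congr_deriv ?_
    simp only [Pi.mul_apply, Pi.add_apply, hR]
    rw [Real.rpow_sub_one ht.ne']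
    field_simp
    ring
  have hRgt : ∀ t, 0 < t → 2 * (1 - β) * besselK ν t < R t := by
    intro t ht
    have hk := besselK_pos ν ht
    have hl := besselK_pos (ν + 1) ht
    have hf := langevin_nonneg ht
    have hC1 := one_lt_coth ht
    have hC : Real.cosh t / Real.sinh t = langevin t + 1 / t := by rw [langevin]; ring
    have hI := coth_ratio_inequality ht (h := 1 / 2 - ν) (by linarith) (by linarith)
    have hs := besselK_succ_ge hν hν2 ht
    rw [hC] at hC1 hI
    rw [show 1 - (1 / 2 - ν) = ν + 1 / 2 by ring,
      show (1 / 2 - ν) / 2 = (1 - 2 * ν) / 4 by ring,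
      show 1 + 2 * (1 / 2 - ν) = 2 - 2 * ν by ring] at hI
    have ht' : 0 < 1 / t := by positivity
    have e0 : 2 * besselK ν t ≤ besselK (ν + 1) t * (langevin t + 1 / t) +
        besselK ν t * (langevin t ^ 2 + (2 - 2 * ν) / t * langevin t) := by
      have h1 := mul_le_mul_of_nonneg_right hI hk.le
      have h2 := mul_le_mul_of_nonneg_right hs (by linarith : 0 ≤ langevin t + 1 / t)
      linarith
    have e1 : besselK (ν + 1) t + langevin t * besselK ν t <
        besselK (ν + 1) t * (langevin t + 1 / t) +
        besselK ν t * (langevin t ^ 2 + (2 - 2 * ν) / t * langevin t) := by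
      have h1 := mul_pos hl (sub_pos.2 hC1)
      have h2 : 0 ≤ besselK ν t * langevin t * (langevin t + (2 - 2 * ν) / t - 1) := by
        refine mul_nonneg (by positivity) ?_
        have h3 : (2 - 2 * ν) / t = 1 / t + (1 - 2 * ν) * (1 / t) := by ring
        have h4 : 0 ≤ (1 - 2 * ν) * (1 / t) := mul_nonneg (by linarith) ht'.le
        linarith
      linarith
    have h1 := mul_le_mul_of_nonneg_left e0 (by linarith : 0 ≤ 1 - β)
    have h2 := mul_lt_mul_of_pos_left e1 hβ0
    simp only [hR]
    linarith
  have hpow : ∀ t, 0 < t → 0 < Real.exp (β * t) * t ^ ν := fun t ht =>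
    mul_pos (Real.exp_pos _) (Real.rpow_pos_of_pos ht _)
  have hCle : ∀ t, 0 < t → 0 ≤ C t ∧ C t ≤ Real.exp (β * t) * t ^ ν * besselK (ν + 1) t +
      Real.exp (β * t) * t ^ ν * besselK ν t := by
    intro t ht
    have hk := besselK_pos ν ht
    have hl := besselK_pos (ν + 1) ht
    have hf := langevin_nonneg ht
    have hp := hpow t ht
    refine ⟨by simp only [hCdef]; positivity, ?_⟩
    rw [← mul_add]
    simp only [hCdef]
    gcongr
    exact mul_le_of_le_one_left hk.le (langevin_le_one ht)
  have hClim : Tendsto C atTop (𝓝 0) := by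
    have h1 := (tendsto_exp_mul_rpow_mul_besselK (ν + 1) ν hβ).add
      (tendsto_exp_mul_rpow_mul_besselK ν ν hβ)
    rw [add_zero] at h1
    refine squeeze_zero' ?_ ?_ h1 <;> filter_upwards [eventually_gt_atTop 0] with t ht
    · exact (hCle t ht).1
    · exact (hCle t ht).2
  have hneg : ∀ t ∈ Ioi x, -(Real.exp (β * t) * t ^ ν * R t) ≤ 0 := by
    intro t ht
    have ht0 : 0 < t := hx.trans ht
    have h1 := hRgt t ht0
    have hk := besselK_pos ν ht0
    have h2 : 0 < 2 * (1 - β) * besselK ν t := mul_pos (by linarith) hk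
    have := mul_pos (hpow t ht0) (h2.trans h1)
    linarith
  -- Integrability of $C'$ needs no estimate: it has one sign and `C` has a limit.
  have hint := integrableOn_Ioi_deriv_of_nonpos' (fun t ht => hderiv t (hx.trans_le ht)) hneg hClim
  have hval := integral_Ioi_of_hasDerivAt_of_tendsto' (fun t ht => hderiv t (hx.trans_le ht))
    hint hClim
  have hA := integrableOn_tail (x := x) hν le_rfl hβ hx.le
  have hpos := setIntegral_Ioi_pos (hint.neg.sub (hA.const_mul (2 * (1 - β)))) (fun t ht => by
    have ht0 : 0 < t := hx.trans ht
    have := mul_lt_mul_of_pos_left (hRgt t ht0) (hpow t ht0)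
    simp only [Pi.sub_apply, Pi.neg_apply]
    linarith)
  have hsub : ∫ t in Ioi x, ((-fun t => -(Real.exp (β * t) * t ^ ν * R t)) -
      fun t => 2 * (1 - β) * (Real.exp (β * t) * t ^ ν * besselK ν t)) t =
      C x - 2 * (1 - β) * ∫ t in Ioi x, Real.exp (β * t) * t ^ ν * besselK ν t := by
    rw [integral_sub' hint.neg (hA.const_mul _), integral_neg', hval, integral_const_mul]
    ring
  rw [hsub] at hpos
  linarith

/-! ### Bounds and limits for the quotients. -/

theorem besselTail_eq (μ ν a β x : ℝ) (hx : 0 < x) (T : ℝ)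
    (hT : ∫ t in Ioi x, Real.exp (β * t) * t ^ (a + 1) * besselK ν t =
      Real.exp (β * x) * x ^ (a + 1) * T) :
    besselTail μ ν a β x = x * (besselI μ x * T) := by
  have h1 := (Real.rpow_pos_of_pos hx a).ne'
  have h2 : Real.exp (-(β * x)) * Real.exp (β * x) = 1 := by
    rw [← Real.exp_add]; simp
  rw [besselTail, hT, Real.rpow_add_one hx.ne']
  field_simp
  linear_combination besselI μ x * T * h2

theorem besselTail_le {μ ν a β x T : ℝ} (hμ : -1 < μ) (hx : 0 < x)
    (hT : ∫ t in Ioi x, Real.exp (β * t) * t ^ (a + 1) * besselK ν t ≤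
      Real.exp (β * x) * x ^ (a + 1) * T) :
    besselTail μ ν a β x ≤ x * (besselI μ x * T) := by
  have hp : 0 < Real.exp (β * x) * x ^ (a + 1) :=
    mul_pos (Real.exp_pos _) (Real.rpow_pos_of_pos hx _)
  rw [besselTail_eq μ ν a β x hx _ (mul_div_cancel₀ _ hp.ne').symm]
  have := besselI_pos hμ hx
  gcongr
  rwa [div_le_iff₀' hp]

theorem besselTail_lt {μ ν a β x T : ℝ} (hμ : -1 < μ) (hx : 0 < x)
    (hT : ∫ t in Ioi x, Real.exp (β * t) * t ^ (a + 1) * besselK ν t <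
      Real.exp (β * x) * x ^ (a + 1) * T) :
    besselTail μ ν a β x < x * (besselI μ x * T) := by
  have hp : 0 < Real.exp (β * x) * x ^ (a + 1) :=
    mul_pos (Real.exp_pos _) (Real.rpow_pos_of_pos hx _)
  rw [besselTail_eq μ ν a β x hx _ (mul_div_cancel₀ _ hp.ne').symm]
  have := besselI_pos hμ hx
  gcongr
  rwa [div_lt_iff₀' hp]

theorem besselTail_succ_lt {ν a β x : ℝ} (hν : -1 / 2 < ν) (ha : ν ≤ a + 1) (hβ : β < 1)
    (hx : 0 < x) :
    besselTail (ν + 1) ν a β x < besselTail ν ν a β x := by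
  have h1 := integral_tail_pos hν ha hβ hx.le
  have h2 := besselI_succ_lt hν hx
  have h3 := Real.rpow_pos_of_pos hx a
  rw [besselTail, besselTail]
  gcongr

theorem tendsto_besselTail {μ ν a β c : ℝ} (hν : -1 / 2 < ν) (ha : ν ≤ a + 1) (hβ : β < 1)
    (hc : Tendsto (fun x => besselI μ x / x ^ a) (𝓝[>] 0) (𝓝 c)) :
    Tendsto (besselTail μ ν a β) (𝓝[>] 0)
      (𝓝 (c * ∫ t in Ioi 0, Real.exp (β * t) * t ^ (a + 1) * besselK ν t)) := by
  have h1 : Tendsto (fun x : ℝ => Real.exp (-β * x)) (𝓝[>] 0) (𝓝 1) := by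
    have h2 : Continuous fun x : ℝ => Real.exp (-β * x) := by fun_prop
    simpa using (h2.tendsto 0).mono_left nhdsWithin_le_nhds
  have h3 := (h1.mul hc).mul (tendsto_integral_tail hν ha hβ)
  rw [one_mul] at h3
  refine h3.congr fun x => ?_
  rw [besselTail, mul_div_assoc]

theorem tendsto_besselTail_zero {μ ν a β : ℝ} (hν : -1 / 2 < ν) (ha : ν ≤ a + 1) (hβ : β < 1)
    (haμ : a < μ) : Tendsto (besselTail μ ν a β) (𝓝[>] 0) (𝓝 0) := by
  simpa using tendsto_besselTail hν ha hβ (tendsto_besselI_div_rpow_zero haμ)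

theorem tendsto_besselTail_self {ν β : ℝ} (hν : -1 / 2 < ν) (hβ : β < 1) :
    Tendsto (besselTail ν ν ν β) (𝓝[>] 0) (𝓝 (1 + β *
      ((∫ t in Ioi 0, Real.exp (β * t) * t ^ (ν + 1) * besselK (ν + 1) t) /
        (2 ^ ν * Real.Gamma (ν + 1))))) := by
  have h := tendsto_besselTail hν (by linarith) hβ (tendsto_besselI_div_rpow ν)
  have hc0 : 0 < (2 : ℝ) ^ ν * Real.Gamma (ν + 1) :=
    mul_pos (Real.rpow_pos_of_pos two_pos _) (Real.Gamma_pos_of_pos (by linarith))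
  rw [integral_zero_succ hν hβ, mul_add, inv_mul_cancel₀ hc0.ne'] at h
  convert h using 3
  ring

theorem besselTail_le_of_nonpos {μ ν β x : ℝ} (hμ : -1 < μ) (hν : -1 / 2 < ν) (hβ : β ≤ 0)
    (hx : 0 < x) : besselTail μ ν ν β x ≤ x * (besselI μ x * besselK (ν + 1) x) := by
  refine besselTail_le hμ hx ?_
  rw [integral_tail_succ hν (by linarith) hx]
  have h1 := integral_tail_pos (p := ν + 1) (by linarith : -1 / 2 < ν + 1) le_rfl
    (by linarith : β < 1) hx.le
  have := mul_nonpos_of_nonpos_of_nonneg hβ h1.le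
  linarith

theorem besselTail_sub_one_le {μ ν β x : ℝ} (hμ : -1 < μ) (hν : -1 / 2 < ν) (hβ : β < 1)
    (hx : 0 < x) : besselTail μ ν (ν - 1) β x ≤ besselTail μ ν ν β x := by
  have h1 : x * ∫ t in Ioi x, Real.exp (β * t) * t ^ ν * besselK ν t ≤
      ∫ t in Ioi x, Real.exp (β * t) * t ^ (ν + 1) * besselK ν t := by
    rw [← integral_const_mul]
    refine setIntegral_mono_on ((integrableOn_tail hν le_rfl hβ hx.le).const_mul _)
      (integrableOn_tail hν (by linarith) hβ hx.le) measurableSet_Ioi fun t ht => ?_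
    have ht0 : 0 < t := hx.trans ht
    have hK := besselK_pos ν ht0
    rw [Real.rpow_add_one ht0.ne']
    calc x * (Real.exp (β * t) * t ^ ν * besselK ν t)
        ≤ t * (Real.exp (β * t) * t ^ ν * besselK ν t) := by gcongr; exact le_of_lt ht
      _ = _ := by ring
  have hI := besselI_pos hμ hx
  have hp := Real.rpow_pos_of_pos hx ν
  rw [besselTail, besselTail, sub_add_cancel, Real.rpow_sub_one hx.ne']
  calc Real.exp (-β * x) * besselI μ x / (x ^ ν / x) *
        ∫ t in Ioi x, Real.exp (β * t) * t ^ ν * besselK ν t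
      = Real.exp (-β * x) * besselI μ x / x ^ ν *
        (x * ∫ t in Ioi x, Real.exp (β * t) * t ^ ν * besselK ν t) := by
        field_simp
    _ ≤ _ := by gcongr

theorem besselTail_lt_of_pos {μ ν β x : ℝ} (hμ : -1 < μ) (hν : -1 / 2 < ν) (hβ0 : 0 < β)
    (hβ : β < 1) (hx : 0 < x) :
    besselTail μ ν ν β x < x * (besselI μ x * besselK (ν + 1) x) *
      (1 + β * (2 * √π * Real.Gamma (ν + 3 / 2) /
        ((1 - β ^ 2) ^ (ν + 3 / 2) * Real.Gamma (ν + 1)))) := by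
  have h : besselTail μ ν ν β x < x * (besselI μ x * (besselK (ν + 1) x *
      (1 + β * (2 * √π * Real.Gamma (ν + 3 / 2) /
        ((1 - β ^ 2) ^ (ν + 3 / 2) * Real.Gamma (ν + 1)))))) := by
    refine besselTail_lt hμ hx ?_
    rw [integral_tail_succ hν hβ hx]
    have := mul_lt_mul_of_pos_left (integral_tail_lt hν hβ hβ0 hx) hβ0
    linarith
  linarith

theorem gamma_ratio_pos {μ β : ℝ} (hμ : -1 / 2 < μ) (hβ : β ^ 2 < 1) :
    0 < 2 * √π * Real.Gamma (μ + 3 / 2) / ((1 - β ^ 2) ^ (μ + 3 / 2) * Real.Gamma (μ + 1)) := by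
  have h1 := Real.Gamma_pos_of_pos (by linarith : 0 < μ + 3 / 2)
  have h2 := Real.Gamma_pos_of_pos (by linarith : 0 < μ + 1)
  have h3 := Real.rpow_pos_of_pos (by linarith : 0 < 1 - β ^ 2) (μ + 3 / 2)
  have h4 := Real.pi_pos
  positivity

theorem boundN_pos {ν β : ℝ} (hβ0 : 0 < β) (hβ : β < 1) : 0 < boundN ν β := by
  rw [boundN]
  split_ifs with h
  · have : 0 < 1 - β := by linarith
    positivity
  · have h1 := gamma_ratio_pos (μ := ν - 1) (β := β) (by linarith) (by nlinarith)
    rw [show ν - 1 + 3 / 2 = ν + 1 / 2 by ring, sub_add_cancel] at h1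
    have h2 : √π * Real.Gamma (ν + 1 / 2) / ((1 - β ^ 2) ^ (ν + 1 / 2) * Real.Gamma ν) =
      (2 * √π * Real.Gamma (ν + 1 / 2) / ((1 - β ^ 2) ^ (ν + 1 / 2) * Real.Gamma ν)) / 2 := by
      ring
    rw [h2]
    exact half_pos h1

theorem besselTail_sub_one_lt_boundN {ν β x : ℝ} (hν : -1 / 2 < ν) (hβ0 : 0 < β) (hβ : β < 1)
    (hx : 0 < x) : besselTail ν ν (ν - 1) β x < boundN ν β := by
  have hν1 : -1 < ν := by linarith
  have hI := besselI_pos hν1 hx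
  rw [boundN]
  split_ifs with h
  · have hb : 0 < 2 * (1 - β) := by linarith
    have hT : besselTail ν ν (ν - 1) β x < x * (besselI ν x *
        ((besselK (ν + 1) x + langevin x * besselK ν x) / (2 * (1 - β)))) := by
      refine besselTail_lt hν1 hx ?_
      rw [sub_add_cancel, mul_div_assoc', lt_div_iff₀ hb, mul_comm _ (2 * (1 - β))]
      exact integral_tail_lt_of_le_half hν h hβ0 hβ hx
    refine hT.trans_le ?_
    have hW := besselI_mul_besselK_wronskian hν hx
    have hK := besselK_pos ν hx
    -- Since $LI_\nu\le I_{\nu+1}$, the product is at most the Wronskian expression, which is $1$.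
    have h1 := mul_le_mul_of_nonneg_left (mul_le_mul_of_nonneg_right
      (langevin_mul_besselI_le hν h hx) hK.le) hx.le
    rw [mul_div_assoc', mul_div_assoc']
    gcongr
    linarith
  · have h' : 1 / 2 < ν := not_le.1 h
    -- The submultiplicative bound is applied with order $\nu-1$; $xI_\nu K_\nu<\frac12$ then halves
    -- its constant $2\sqrt\pi$.
    have hμ : -1 / 2 < ν - 1 := by linarith
    have hT := integral_tail_lt hμ hβ hβ0 hx
    have hG := gamma_ratio_pos (β := β) hμ (by nlinarith)
    have hhalf := mul_besselI_mul_besselK_lt_half hμ hx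
    simp only [sub_add_cancel, show ν - 1 + 3 / 2 = ν + 1 / 2 by ring] at hT hG hhalf
    rw [mul_assoc] at hT
    have h1 := besselTail_lt (a := ν - 1) hν1 hx (by rw [sub_add_cancel]; exact hT)
    have h2 := mul_lt_mul_of_pos_right hhalf hG
    refine h1.trans_le (le_trans (le_of_eq ?_) (h2.le.trans_eq ?_)) <;> ring

/-! ### The theorem. -/

theorem mainTheorem4 (ν β : ℝ) (hν : -1 / 2 < ν) :
    -- the integrals converge
    (β < 1 → ∀ x : ℝ, 0 ≤ x →
      IntegrableOn (fun t : ℝ => Real.exp (β * t) * t ^ (ν + 1) * besselK ν t) (Ioi x) ∧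
      IntegrableOn (fun t : ℝ => Real.exp (β * t) * t ^ ν * besselK ν t) (Ioi x)) ∧
    -- (i) and (ii)
    (β ≤ 0 →
      ((∀ x : ℝ, 0 < x → besselTail ν ν ν β x < 1) ∧
        ∃ L : ℝ, Tendsto (besselTail ν ν ν β) (𝓝[>] 0) (𝓝 L) ∧ L ≤ 1 ∧ (L = 1 ↔ β = 0)) ∧
      LtOnNonneg (besselTail (ν + 1) ν ν β) (1 / 2) ∧
      LtOnNonneg (besselTail ν ν (ν - 1) β) 1 ∧
      LtOnNonneg (besselTail (ν + 1) ν (ν - 1) β) (1 / 2)) ∧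
    -- (iii) and (iv)
    (0 < β → β < 1 →
      LtOnNonneg (besselTail ν ν ν β)
        (1 + 2 * √π * β * Real.Gamma (ν + 3 / 2) /
          ((1 - β ^ 2) ^ (ν + 3 / 2) * Real.Gamma (ν + 1))) ∧
      LtOnNonneg (besselTail (ν + 1) ν ν β)
        (1 / 2 + √π * β * Real.Gamma (ν + 3 / 2) /
          ((1 - β ^ 2) ^ (ν + 3 / 2) * Real.Gamma (ν + 1))) ∧
      LtOnNonneg (besselTail ν ν (ν - 1) β) (boundN ν β) ∧
      LtOnNonneg (besselTail (ν + 1) ν (ν - 1) β) (boundN ν β)) := by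
  have hν0 : -1 < ν := by linarith
  have hν1 : -1 < ν + 1 := by linarith
  have hc0 : 0 < (2 : ℝ) ^ ν * Real.Gamma (ν + 1) :=
    mul_pos (Real.rpow_pos_of_pos two_pos _) (Real.Gamma_pos_of_pos (by linarith))
  refine ⟨fun hβ x hx => ⟨integrableOn_tail hν (by linarith) hβ hx,
    integrableOn_tail hν le_rfl hβ hx⟩, fun hβ => ?_, fun hβ0 hβ => ?_⟩
  · have hβ1 : β < 1 := by linarith
    have hA : ∀ x, 0 < x → besselTail ν ν ν β x < 1 := fun x hx =>
      (besselTail_le_of_nonpos hν0 hν hβ hx).trans_lt (mul_besselI_mul_besselK_succ_lt_one hν hx)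
    have hB : ∀ x, 0 < x → besselTail (ν + 1) ν ν β x < 1 / 2 := fun x hx =>
      (besselTail_le_of_nonpos hν1 hν hβ hx).trans_lt (mul_besselI_mul_besselK_lt_half hν hx)
    -- The limit at $0$ is $1+\beta M$ with this $M$; its positivity makes $\beta=0$ the only case
    -- of equality.
    have hM : 0 < (∫ t in Ioi 0, Real.exp (β * t) * t ^ (ν + 1) * besselK (ν + 1) t) /
        (2 ^ ν * Real.Gamma (ν + 1)) :=
      div_pos (integral_tail_pos (by linarith) le_rfl hβ1 le_rfl) hc0
    refine ⟨⟨hA, _, tendsto_besselTail_self hν hβ1, ?_, ?_⟩, ⟨hB, 0, ?_, by norm_num⟩,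
      ⟨fun x hx => (besselTail_sub_one_le hν0 hν hβ1 hx).trans_lt (hA x hx), 0, ?_, one_pos⟩,
      ⟨fun x hx => (besselTail_sub_one_le hν1 hν hβ1 hx).trans_lt (hB x hx), 0, ?_,
        by norm_num⟩⟩
    · have := mul_nonpos_of_nonpos_of_nonneg hβ hM.le
      linarith
    · rw [add_eq_left, mul_eq_zero, or_iff_left hM.ne']
    all_goals exact tendsto_besselTail_zero hν (by linarith) hβ1 (by linarith)
  · have hβ2 : β ^ 2 < 1 := by nlinarith
    have hN := gamma_ratio_pos hν hβ2
    have hpos := boundN_pos (ν := ν) hβ0 hβ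
    have hD := fun x (hx : 0 < x) => besselTail_sub_one_lt_boundN hν hβ0 hβ hx
    have hN1 : 2 * √π * β * Real.Gamma (ν + 3 / 2) /
        ((1 - β ^ 2) ^ (ν + 3 / 2) * Real.Gamma (ν + 1)) = β * (2 * √π * Real.Gamma (ν + 3 / 2) /
        ((1 - β ^ 2) ^ (ν + 3 / 2) * Real.Gamma (ν + 1))) := by ring
    have hN2 : √π * β * Real.Gamma (ν + 3 / 2) /
        ((1 - β ^ 2) ^ (ν + 3 / 2) * Real.Gamma (ν + 1)) =
        β * (2 * √π * Real.Gamma (ν + 3 / 2) /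
        ((1 - β ^ 2) ^ (ν + 3 / 2) * Real.Gamma (ν + 1))) / 2 := by ring
    rw [hN1, hN2]
    have hint := integral_zero_lt hν hβ2
    set N := 2 * √π * Real.Gamma (ν + 3 / 2) /
        ((1 - β ^ 2) ^ (ν + 3 / 2) * Real.Gamma (ν + 1)) with hNdef
    have hβN : 0 < 1 + β * N := by positivity
    refine ⟨⟨fun x hx => ?_, _, tendsto_besselTail_self hν hβ, ?_⟩,
      ⟨fun x hx => ?_, 0, ?_, by positivity⟩, ⟨hD, 0, ?_, hpos⟩,
      ⟨fun x hx => (besselTail_succ_lt hν (by linarith) hβ hx).trans (hD x hx), 0, ?_, hpos⟩⟩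
    · have h1 := besselTail_lt_of_pos hν0 hν hβ0 hβ hx
      have h2 := mul_lt_mul_of_pos_right (mul_besselI_mul_besselK_succ_lt_one hν hx) hβN
      rw [one_mul] at h2
      exact h1.trans h2
    · gcongr
      rwa [div_lt_iff₀' hc0]
    · have h1 := besselTail_lt_of_pos hν1 hν hβ0 hβ hx
      have h2 := mul_lt_mul_of_pos_right (mul_besselI_mul_besselK_lt_half hν hx) hβN
      refine h1.trans (h2.trans_eq ?_)
      ring
    all_goals exact tendsto_besselTail_zero hν (by linarith) hβ (by linarith)
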